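/- \textbf{Setting.} Let $X_o$ be a compact Hausdorff space, $\theta_o$ a homeomorphism of $X_o$ which is uniquely ergodic, i.e. there is exactly one $\theta_o$-invariant regular Borel probability measure $\mu_o$ on $X_o$, and let $f\in C(X_o;\mathbb T)$. Let $\Phi(x,z)=(\theta_o(x),f(x)z)$ be the Anzai skew-product on $X_o\times\mathbb T$, acting on $C(X_o\times\mathbb T)$ by $h\mapsto h\circ\Phi$, with fixed-point subalgebra $C(X_o\times\mathbb T)^\Phi$. Let $m$ be the normalised Haar measure of $\mathbb T$, $\mu=\mu_o\times m$ and $\chi_l(z)=z^l$. For $n\in\mathbb Z$ consider the cohomological equations $$(\mathrm a)\ \ g(\theta_o(x))f(x)^n=g(x)\ \ \mu_o\text{-a.e.},\quad g\in L^\infty(X_o,\mu_o);\qquad (\mathrm b)\ \ G(\theta_o(x))f(x)^n=G(x)\ \ \text{for all }x,\quad G\in C(X_o).$$ Let $n_o\ge 0$ (resp. $m_o\ge0$) be the generator of the group of those $n\in\mathbb Z$ for which (a) (resp. (b)) has a nonzero solution, and let $k_o\ge0$ be the integer with $m_o=k_on_o$ ($k_o=0$ if $m_o=0$). A \emph{choice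 of unitary solutions} is a pair $(u,v)$, where $u:X_o\to\mathbb T$ is measurable and solves (a) for $n=n_o$, and $v:X_o\to\mathbb T$ is continuous, solves (b) for $n=m_o$, and satisfies $v=u^{k_o}$ $\mu_o$-a.e. \textbf{The canonical expectation.} If $m_o=0$, put $E_{\rm can}(h)=\big(\int h\,d\mu\big)1$. If $m_o>0$, put $E_{\rm can}=E_{\frac1{k_o}1}$, where for $A\in M_{k_o}(\mathbb C)$ the map $E_A=\sigma\circ F_A\circ\rho_1\circ T$ on $C(X_o\times\mathbb T)$ is built as follows. \begin{itemize} \item With $a_l(x,z)=(u(x)z^{n_o})^l$ and $h_n(x)=\int h(x,z)z^{-n}\,dm(z)$, $T(h)=\sum_{l\in\mathbb Z}\Big(\int h_{ln_o}u^{-l}\,d\mu_o\Big)a_l$, the sum being taken in the Ces\`aro sense in the norm of $L^\infty(X_o\times\mathbb T,\mu)$. \item $\rho_1$ is the $*$-isomorphism onto $C(\mathbb T)$ of the $C^*$-algebra generated by the $a_l$, with $\rho_1(a_l)=\chi_l$. \item $F_A=\pi_{k_o}^{-1}\circ\widetilde F_A\circ\pi_{k_o}$, where $\pi_k:C(\mathbb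 T)\to M_k(C(\mathbb T))$ is the $*$-monomorphism sending $\chi_l$ to $U_k^l$, $U_k$ is the unitary with entries $1$ just below the diagonal, $\chi_1$ in the upper right corner and $0$ elsewhere, and $\widetilde F_A(x)=\mathrm{Tr}(Ax)1$. The range of $F_A$ lies in $\{q(z^{k_o}): q\in C(\mathbb T)\}$. \item $\sigma$ sends the function $q(z^{k_o})$, $q\in C(\mathbb T)$, to the function $(x,z)\mapsto q(v(x)z^{m_o})$. \end{itemize} \textbf{Theorem.} A choice of unitary solutions $(u,v)$ exists. For every such choice, $E_{\rm can}$ is a $\Phi$-invariant conditional expectation of $C(X_o\times\mathbb T)$ onto $C(X_o\times\mathbb T)^\Phi$, and the following conditions are equivalent: \begin{itemize} \item[(i)] $\Phi$ is uniquely ergodic with respect to the fixed-point subalgebra, i.e. $\frac1n\sum_{k=0}^{n-1}h\circ\Phi^k$ converges in norm for every $h\in C(X_o\times\mathbb T)$; \item[(ii)] there exists exactly one $\Phi$-invariant conditional expectation of $C(X_o\times\mathbb T)$ onto $C(X_o\times\mathbb T)^\Phi$; \item[(iii)] every measurable solution of the cohomological equations is continuous: if $g\in L^\infty(X_o,\mu_o)$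 solves (a) for some $n\in\mathbb Z$, then $g=G$ $\mu_o$-a.e. for some $G\in C(X_o)$ which solves (b) for the same $n$; \item[(iv)] $E_{\rm can}$ is an extreme point of the convex set of all $\Phi$-invariant conditional expectations of $C(X_o\times\mathbb T)$ onto $C(X_o\times\mathbb T)^\Phi$. \end{itemize} -/

import Mathlib

open MeasureTheory Filter Topology
open scoped ComplexOrder ENNReal

noncomputable section

namespace Anzai

/-! ### C*-dynamical systems and invariant conditional expectations -/

section CStar

variable {A : Type*} [CStarAlgebra A]

/-- The fixed-point subalgebra of a `*`-automorphism. -/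
def fixedSubalgebra (α : A ≃⋆ₐ[ℂ] A) : StarSubalgebra ℂ A where
  carrier := {a | α a = a}
  mul_mem' {a b} ha hb := by
    simp only [Set.mem_ofPred_eq] at ha hb ⊢
    rw [map_mul, ha, hb]
  add_mem' {a b} ha hb := by
    simp only [Set.mem_ofPred_eq] at ha hb ⊢
    rw [map_add, ha, hb]
  algebraMap_mem' r := by
    simp only [Set.mem_ofPred_eq]
    exact AlgHomClass.commutes α r
  star_mem' {a} ha := by
    simp only [Set.mem_ofPred_eq] at ha ⊢
    rw [map_star, ha]

/-- Unique ergodicity with respect to the fixed-point subalgebra: the Cesàro averages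
`(1/n) ∑_{k<n} α^k(a)` converge in norm for every `a`. -/
def UniquelyErgodicWrtFixed (α : A ≃⋆ₐ[ℂ] A) : Prop :=
  ∀ a : A, ∃ b : A,
    Tendsto (fun n : ℕ => (n : ℂ)⁻¹ • ∑ k ∈ Finset.range n, (α : A → A)^[k] a) atTop (𝓝 b)

/-- `E` is a conditional expectation of `A` onto the subalgebra `B`: a positive linear projection
onto `B` which is a `B`-bimodule map. -/
structure IsCondExp [PartialOrder A] [StarOrderedRing A] (B : StarSubalgebra ℂ A) (E : A → A) :
    Prop where
  linear : IsLinearMap ℂ E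
  mem : ∀ a, E a ∈ B
  apply_of_mem : ∀ b ∈ B, E b = b
  nonneg : ∀ a, 0 ≤ a → 0 ≤ E a
  left_mul : ∀ b ∈ B, ∀ a, E (b * a) = b * E a
  right_mul : ∀ b ∈ B, ∀ a, E (a * b) = E a * b

/-- The set of `α`-invariant conditional expectations onto the fixed-point subalgebra of `α`. -/
def invariantCondExps [PartialOrder A] [StarOrderedRing A] (α : A ≃⋆ₐ[ℂ] A) : Set (A → A) :=
  {E | IsCondExp (fixedSubalgebra α) E ∧ ∀ a, E (α a) = E a}

end CStar

/-! ### The circle -/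

instance instMeasurableSpaceCircle : MeasurableSpace Circle := borel Circle

instance instBorelSpaceCircle : BorelSpace Circle := ⟨rfl⟩

/-- The normalised Haar measure of the circle. -/
def haarCircle : Measure Circle := Measure.haarMeasure ⊤

/-- The character `χ_n(z) = z ^ n` of the circle. -/
def character (n : ℤ) : C(Circle, ℂ) where
  toFun z := ((z ^ n : Circle) : ℂ)
  continuous_toFun := continuous_subtype_val.comp (continuous_zpow n)

/-! ### The maps `F_A` on `C(𝕋)` -/

/-- The unitary `U_k` of `M_k(C(𝕋))`, with `1` just below the diagonal and the function `z` in the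
upper right corner. -/
def shiftUnitary (k : ℕ) : CStarMatrix (Fin k) (Fin k) C(Circle, ℂ) :=
  CStarMatrix.ofMatrix fun i j =>
    if (i : ℕ) = (j : ℕ) + 1 then 1
    else if (i : ℕ) = 0 ∧ (j : ℕ) + 1 = k then character 1 else 0

/-- The `*`-monomorphism `π_k : C(𝕋) → M_k(C(𝕋))` with `π_k(χ_l) = U_k ^ l`, that is
`π_k(q) = q(U_k)`, the continuous functional calculus of the unitary `U_k`. The function `q` is
extended by `0` off the circle, which contains the spectrum of `U_k`. -/
def piHom (k : ℕ) (q : C(Circle, ℂ)) : CStarMatrix (Fin k) (Fin k) C(Circle, ℂ) :=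
  cfc (Function.extend ((↑) : Circle → ℂ) q 0) (shiftUnitary k)

/-- `F̃_A(x) = Tr(A x) 1`, for a scalar matrix `A` and `x ∈ M_k(C(𝕋))`. -/
def traceExp {k : ℕ} (A : Matrix (Fin k) (Fin k) ℂ)
    (x : CStarMatrix (Fin k) (Fin k) C(Circle, ℂ)) : CStarMatrix (Fin k) (Fin k) C(Circle, ℂ) :=
  CStarMatrix.ofMatrix (Matrix.scalar (Fin k) (∑ i, ∑ j, A i j • x j i))

/-- `F_A = π_k⁻¹ ∘ F̃_A ∘ π_k`, with values in the algebra `B_k` generated by the powers of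
`z ^ k`. -/
def circleExp {k : ℕ} (A : Matrix (Fin k) (Fin k) ℂ) (q : C(Circle, ℂ)) : C(Circle, ℂ) :=
  Function.invFun (piHom k) (traceExp A (piHom k q))

/-- The embedding `q ↦ q(z ^ k)` of `C(𝕋)` into itself; for `k ≥ 1` it is an isomorphism onto
`B_k`. -/
def powEmb (k : ℕ) (q : C(Circle, ℂ)) : C(Circle, ℂ) where
  toFun z := q (z ^ k)
  continuous_toFun := by fun_prop

/-! ### Anzai skew-products and cohomological equations -/

section Skew

variable {X : Type*} [TopologicalSpace X]

/-- The Anzai skew-product `(x, z) ↦ (θ x, f(x) z)` on `X × 𝕋`. -/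
def skewProduct (θ : X ≃ₜ X) (f : C(X, Circle)) : (X × Circle) ≃ₜ (X × Circle) where
  toFun p := (θ p.1, f p.1 * p.2)
  invFun p := (θ.symm p.1, (f (θ.symm p.1))⁻¹ * p.2)
  left_inv p := by simp
  right_inv p := by simp
  continuous_toFun := by fun_prop
  continuous_invFun := by fun_prop

/-- The `*`-automorphism `h ↦ h ∘ Φ` of `C(X × 𝕋)` given by the skew-product `Φ`. -/
def skewAut (θ : X ≃ₜ X) (f : C(X, Circle)) : C(X × Circle, ℂ) ≃⋆ₐ[ℂ] C(X × Circle, ℂ) :=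
  (skewProduct θ f).compStarAlgEquiv' ℂ ℂ

variable [MeasurableSpace X]

/-- `μ` is the unique `θ`-invariant regular Borel probability measure. -/
structure IsUniqueInvariantMeasure (θ : X ≃ₜ X) (μ : Measure X) : Prop where
  isProbabilityMeasure : IsProbabilityMeasure μ
  regular : μ.Regular
  invariant : μ.map θ = μ
  unique : ∀ ν : Measure X, IsProbabilityMeasure ν → ν.Regular → ν.map θ = ν → ν = μ

/-- `g ∈ L^∞(X, μ)` solves the cohomological equation `g(θ x) f(x)^n = g(x)`, `μ`-a.e. -/
def IsMeasurableSolution (θ : X ≃ₜ X) (μ : Measure X) (f : C(X, Circle)) (n : ℤ)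
    (g : Lp ℂ ∞ μ) : Prop :=
  ∀ᵐ x ∂μ, g (θ x) * ((f x ^ n : Circle) : ℂ) = g x

/-- `G ∈ C(X)` solves the cohomological equation `G(θ x) f(x)^n = G(x)` everywhere. -/
def IsContinuousSolution (θ : X ≃ₜ X) (f : C(X, Circle)) (n : ℤ) (G : C(X, ℂ)) : Prop :=
  ∀ x, G (θ x) * ((f x ^ n : Circle) : ℂ) = G x

/-- `n_o ≥ 0`, the generator of the group of those `n ∈ ℤ` for which there are nontrivial measurable
solutions: its least positive element, and `0` if there is none. -/
def nZero (θ : X ≃ₜ X) (μ : Measure X) (f : C(X, Circle)) : ℕ :=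
  sInf {n : ℕ | 0 < n ∧ ∃ g : Lp ℂ ∞ μ, IsMeasurableSolution θ μ f n g ∧ g ≠ 0}

/-- `m_o ≥ 0`, the generator of the group of those `n ∈ ℤ` for which there are nontrivial continuous
solutions: its least positive element, and `0` if there is none. -/
def mZero (θ : X ≃ₜ X) (f : C(X, Circle)) : ℕ :=
  sInf {n : ℕ | 0 < n ∧ ∃ G : C(X, ℂ), IsContinuousSolution θ f n G ∧ G ≠ 0}

/-- The integer `k_o ≥ 0` with `m_o = k_o n_o` (the division is exact; `k_o = 0` if `m_o = 0`). -/
def kZero (θ : X ≃ₜ X) (μ : Measure X) (f : C(X, Circle)) : ℕ :=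
  mZero θ f / nZero θ μ f

/-- A choice of the unitary solutions entering the construction of the conditional expectations:
a measurable one `u = u_{n_o}` at the level `n_o`, and a continuous one `v` at the level
`m_o = k_o n_o`, where `v` is the continuous version of `u ^ k_o`. -/
structure UnitarySolutions (θ : X ≃ₜ X) (μ : Measure X) (f : C(X, Circle)) where
  u : X → Circle
  measurable_u : Measurable u
  u_eq : ∀ᵐ x ∂μ, u (θ x) * f x ^ nZero θ μ f = u x
  v : C(X, Circle)
  v_eq : ∀ x, v (θ x) * f x ^ mZero θ f = v x
  v_ae_eq : ∀ᵐ x ∂μ, v x = u x ^ kZero θ μ f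

/-! ### The conditional expectations `E_A` -/

theorem memLp_comp {Y : Type*} [MeasurableSpace Y] (ν : Measure Y) (q : C(Circle, ℂ))
    {w : Y → Circle} (hw : Measurable w) : MemLp (fun y => q (w y)) ∞ ν :=
  memLp_top_of_bound (q.continuous.measurable.comp hw).aestronglyMeasurable ‖q‖
    (Eventually.of_forall fun _ => q.norm_coe_le_norm _)

namespace UnitarySolutions

variable {θ : X ≃ₜ X} {μ : Measure X} {f : C(X, Circle)}

/-- The invariant function `u(x) z ^ n_o` on `X × 𝕋`. -/
def base (D : UnitarySolutions θ μ f) (p : X × Circle) : Circle :=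
  D.u p.1 * p.2 ^ nZero θ μ f

theorem measurable_base (D : UnitarySolutions θ μ f) : Measurable D.base :=
  (D.measurable_u.comp measurable_fst).mul (measurable_snd.pow_const _)

/-- The inverse `ρ_1⁻¹ : C(𝕋) → A_1 ⊆ L^∞(X × 𝕋, μ × m)` of the isomorphism `ρ_1`: it sends `q` to the
class of `q(u(x) z ^ n_o)`, and thus `χ_n` to `a_n`. -/
def rhoInv (D : UnitarySolutions θ μ f) (q : C(Circle, ℂ)) : Lp ℂ ∞ (μ.prod haarCircle) :=
  (memLp_comp (μ.prod haarCircle) q D.measurable_base).toLp _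

/-- The `*`-isomorphism `ρ_1 : A_1 → C(𝕋)`, with `ρ_1(a_n) = χ_n`. -/
def rho (D : UnitarySolutions θ μ f) : Lp ℂ ∞ (μ.prod haarCircle) → C(Circle, ℂ) :=
  Function.invFun D.rhoInv

/-- The class `a_n` of the function `(u(x) z ^ n_o) ^ n`. -/
def a (D : UnitarySolutions θ μ f) (n : ℤ) : Lp ℂ ∞ (μ.prod haarCircle) :=
  D.rhoInv (character n)

/-- The Fourier coefficient `h_n(x) = ∫ h(x, z) z ^ (-n) dm(z)`. -/
def fourierCoeff (h : C(X × Circle, ℂ)) (n : ℤ) (x : X) : ℂ :=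
  ∫ z, h (x, z) * ((z ^ (-n) : Circle) : ℂ) ∂haarCircle

/-- The map `T(h) = ∑_{l ∈ ℤ} (∫ h_{l n_o} u ^ (-l) dμ) a_l`, the sum of the series being the limit in
the norm of `L^∞` of the arithmetic means of its symmetric partial sums. -/
def T (D : UnitarySolutions θ μ f) (h : C(X × Circle, ℂ)) : Lp ℂ ∞ (μ.prod haarCircle) :=
  limUnder atTop fun N : ℕ =>
    (N : ℂ)⁻¹ • ∑ j ∈ Finset.range N, ∑ l ∈ Finset.Icc (-(j : ℤ)) (j : ℤ),
      (∫ x, fourierCoeff h (l * nZero θ μ f) x * ((D.u x ^ (-l) : Circle) : ℂ) ∂μ) • D.a l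

/-- The map `σ : C(𝕋) → C(X × 𝕋)`, `σ(q)(x, z) = q(v(x) z ^ m_o)`, an isomorphism onto the fixed-point
subalgebra when `m_o > 0`. -/
def sigma (D : UnitarySolutions θ μ f) (q : C(Circle, ℂ)) : C(X × Circle, ℂ) where
  toFun p := q (D.v p.1 * p.2 ^ mZero θ f)
  continuous_toFun := by fun_prop

/-- `E_A = σ ∘ F_A ∘ ρ_1 ∘ T`, where the range `B_{k_o}` of `F_A` is identified with `C(𝕋)` through
`χ_{k_o l} ↔ χ_l` before `σ` is applied. -/
def condExp (D : UnitarySolutions θ μ f)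
    (A : Matrix (Fin (kZero θ μ f)) (Fin (kZero θ μ f)) ℂ) (h : C(X × Circle, ℂ)) :
    C(X × Circle, ℂ) :=
  D.sigma (Function.invFun (powEmb (kZero θ μ f)) (circleExp A (D.rho (D.T h))))

/-- The canonical expectation `E_can`: it is `h ↦ (∫ h d(μ × m)) 1` if `m_o = 0`, and `E_A` with
`A = (1 / k_o) 1` if `m_o > 0`. -/
def canonicalExp (D : UnitarySolutions θ μ f) (h : C(X × Circle, ℂ)) : C(X × Circle, ℂ) :=
  if mZero θ f = 0 then ContinuousMap.const _ (∫ p, h p ∂(μ.prod haarCircle))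
  else D.condExp ((kZero θ μ f : ℂ)⁻¹ • 1) h

end UnitarySolutions

end Skew

end Anzai

end

noncomputable section

set_option linter.unusedSectionVars false

namespace Anzai

/-! ### Density and convergence principles -/

/-! Fourier expansion in the circle variable splits `C(X × 𝕋)` into sectors `g ⊗ χ_n`, on which the
automorphism acts by `g ↦ (g ∘ θ) f ^ n`. At `n = 0` unique ergodicity makes the averages converge
uniformly to the integral. A continuous unitary solution at level `n` conjugates that sector to the
sector `0`. If level `n` has no measurable unitary solution, the averages tend to zero
(`tendsto_average_twist_of_no_solution`): a nonzero ultrafilter limit of point evaluations would be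
dominated by `μ`, hence have an `L²` density whose conjugate solves the equation. By density and
contractivity, (iii) gives (i).

For (i) ⇒ (ii), an invariant expectation is continuous, constant on the averages of an element, and
fixes their limit. A unique expectation is trivially extreme, so (ii) ⇒ (iv).

For (iv) ⇒ (iii), condition (iii) follows from `m_o ∣ n_o`. If this fails, `Re (u z ^ n_o)` is a
nonzero invariant function orthogonal to the fixed-point subalgebra. The weights `1 ± Re (u z ^
n_o)` are nonnegative and agree with `1` on that subalgebra, so they define two invariant
expectations with midpoint `E_can`, distinct from it.

The passage from a weight `p` to an expectation rests on duality: `E h` is determined by `∫ (E h) b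
= ∫ h b p(u z ^ n_o)` for fixed `b`, because the product measure is faithful on continuous fixed
elements (`eq_zero_of_mem_fixed_of_nonneg`). That a continuous `E h` exists comes from the explicit
construction: `ρ_1 ∘ T` is the conditional expectation along `u z ^ n_o`, by norm convergence of
Fejér sums (`exists_tendsto_fejerSum`), and `F_A` with `A = (1 / k_o) 1` is the mean over `k_o`-th
roots (`invFun_powEmb_circleExp`). -/

theorem closed_submodule_eq_top {Y : Type*} [TopologicalSpace Y] [CompactSpace Y]
    (G : Set C(Y, ℂ)) (h_one : 1 ∈ G) (h_mul : ∀ a ∈ G, ∀ b ∈ G, a * b ∈ G)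
    (h_star : ∀ a ∈ G, star a ∈ G) (h_sep : ∀ x y : Y, x ≠ y → ∃ a ∈ G, a x ≠ a y)
    (S : Submodule ℂ C(Y, ℂ)) (hS : IsClosed (S : Set C(Y, ℂ))) (hG : G ⊆ S) : S = ⊤ := by
  -- Closure of `G` under products and stars makes its linear span a `*`-subalgebra already, to
  -- which Stone–Weierstrass applies.
  let A : StarSubalgebra ℂ C(Y, ℂ) :=
    { (Submodule.span ℂ G).toSubalgebra (Submodule.subset_span h_one) (by
        intro a b ha hb
        induction ha, hb using Submodule.span_induction₂ with
        | mem_mem x y hx hy => exact Submodule.subset_span (h_mul x hx y hy)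
        | zero_left => simp
        | zero_right => simp
        | add_left x y z _ _ _ h1 h2 => rw [add_mul]; exact add_mem h1 h2
        | add_right x y z _ _ _ h1 h2 => rw [mul_add]; exact add_mem h1 h2
        | smul_left r x y _ _ h => rw [smul_mul_assoc]; exact Submodule.smul_mem _ _ h
        | smul_right r x y _ _ h => rw [mul_smul_comm]; exact Submodule.smul_mem _ _ h) with
      star_mem' := by
        intro a ha
        change star a ∈ Submodule.span ℂ G
        change a ∈ Submodule.span ℂ G at ha
        induction ha using Submodule.span_induction with
        | mem x hx => exact Submodule.subset_span (h_star x hx)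
        | zero => simp
        | add x y _ _ h1 h2 => rw [star_add]; exact add_mem h1 h2
        | smul r x _ h => rw [star_smul]; exact Submodule.smul_mem _ _ h }
  have hA : A.topologicalClosure = ⊤ := by
    refine ContinuousMap.starSubalgebra_topologicalClosure_eq_top_of_separatesPoints A ?_
    intro x y hxy
    obtain ⟨a, ha, hne⟩ := h_sep x y hxy
    exact ⟨a, ⟨a, Submodule.subset_span ha, rfl⟩, hne⟩
  have hAS : (A : Set C(Y, ℂ)) ⊆ S := fun a ha => (Submodule.span_le.2 hG) ha
  rw [eq_top_iff]
  intro a _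
  have : a ∈ A.topologicalClosure := hA ▸ StarSubalgebra.mem_top
  exact closure_minimal hAS hS this

/-- The vectors at which a sequence of linear maps converges. -/
def convergenceSubmodule {V W : Type*} [AddCommGroup V] [Module ℂ V]
    [NormedAddCommGroup W] [NormedSpace ℂ W] (L : ℕ → V →ₗ[ℂ] W) : Submodule ℂ V where
  carrier := {v | ∃ w, Tendsto (fun N => L N v) atTop (𝓝 w)}
  add_mem' := by
    rintro a b ⟨w, hw⟩ ⟨w', hw'⟩
    exact ⟨w + w', by simpa using hw.add hw'⟩
  zero_mem' := ⟨0, by simp⟩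
  smul_mem' := by
    rintro c a ⟨w, hw⟩
    exact ⟨c • w, by simpa using hw.const_smul c⟩

/-- An `ε/4` argument from the uniform bound. Convergence of both the Fejér sums and the ergodic
averages is thereby reduced to generators. -/
theorem isClosed_convergenceSubmodule {V W : Type*} [NormedAddCommGroup V] [NormedSpace ℂ V]
    [NormedAddCommGroup W] [NormedSpace ℂ W] [CompleteSpace W] (L : ℕ → V →ₗ[ℂ] W)
    (hL : ∀ N v, ‖L N v‖ ≤ ‖v‖) : IsClosed (convergenceSubmodule L : Set V) := by
  refine isClosed_of_closure_subset fun v hv => ?_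
  refine cauchySeq_tendsto_of_complete (Metric.cauchySeq_iff'.2 fun ε hε => ?_)
  obtain ⟨v', ⟨w, hw⟩, hvv⟩ := Metric.mem_closure_iff.1 hv (ε / 4) (by positivity)
  obtain ⟨N, hN⟩ := Metric.cauchySeq_iff'.1 hw.cauchySeq (ε / 4) (by positivity)
  refine ⟨N, fun n hn => ?_⟩
  have key : ∀ n, dist (L n v) (L n v') < ε / 4 := fun n => by
    rw [dist_eq_norm, ← map_sub]
    exact (hL n _).trans_lt (by rwa [← dist_eq_norm])
  have h1 := key n
  have h2 := key N
  have h3 := hN n hn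
  rw [dist_comm] at h2
  have h4 := dist_triangle4 (L n v) (L n v') (L N v') (L N v)
  linarith

/-! ### Haar measure and characters of the circle -/

instance isProbabilityMeasure_haarCircle : IsProbabilityMeasure haarCircle :=
  ⟨by simpa [haarCircle] using Measure.haarMeasure_self (G := Circle) (K₀ := ⊤)⟩

instance isHaarMeasure_haarCircle : haarCircle.IsHaarMeasure := by
  unfold haarCircle; infer_instance

theorem character_apply (n : ℤ) (z : Circle) : character n z = ((z ^ n : Circle) : ℂ) := rfl

theorem character_zero : character 0 = 1 := by ext; simp [character_apply]

theorem character_add (m n : ℤ) : character (m + n) = character m * character n := by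
  ext; simp [character_apply, zpow_add]

theorem star_character (n : ℤ) : star (character n) = character (-n) := by
  ext z
  simp only [ContinuousMap.star_apply, character_apply]
  rw [zpow_neg, Circle.coe_inv_eq_conj]; rfl

theorem integrable_haarCircle (q : C(Circle, ℂ)) : Integrable q haarCircle :=
  q.continuous.integrable_of_hasCompactSupport (HasCompactSupport.of_compactSpace _)

theorem integral_haarCircle_mul_left (q : Circle → ℂ) (w : Circle) :
    ∫ z, q (w * z) ∂haarCircle = ∫ z, q z ∂haarCircle :=
  integral_mul_left_eq_self q w

theorem exists_circle_zpow_ne_one {n : ℤ} (hn : n ≠ 0) : ∃ w : Circle, w ^ n ≠ 1 := by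
  -- The `n`-th power of this point is `-1`.
  refine ⟨Circle.exp (Real.pi / n), fun h => ?_⟩
  rw [← Circle.exp_zsmul, zsmul_eq_mul, mul_div_cancel₀ _ (by exact_mod_cast hn)] at h
  have := congrArg ((↑) : Circle → ℂ) h
  norm_num at this

theorem integral_character_comp {Y : Type*} [MeasurableSpace Y] (ν : Measure Y) (w : Y → Circle)
    (c : Circle) (n : ℤ) (h : ∫ y, character n (c * w y) ∂ν = ∫ y, character n (w y) ∂ν)
    (hc : c ^ n ≠ 1) : ∫ y, character n (w y) ∂ν = 0 := by
  simp only [character_apply, mul_zpow, Circle.coe_mul] at h ⊢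
  rw [integral_const_mul] at h
  have : ((c ^ n : Circle) : ℂ) - 1 ≠ 0 := by
    rw [sub_ne_zero]; rwa [Ne, Circle.coe_eq_one]
  have h2 : (((c ^ n : Circle) : ℂ) - 1) * ∫ y, ((w y ^ n : Circle) : ℂ) ∂ν = 0 := by
    rw [sub_mul, h]; ring
  exact (mul_eq_zero.1 h2).resolve_left this

theorem integral_character (n : ℤ) :
    ∫ z, character n z ∂haarCircle = if n = 0 then 1 else 0 := by
  split_ifs with h
  · subst h; simp [character_zero]
  · obtain ⟨w, hw⟩ := exists_circle_zpow_ne_one h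
    exact integral_character_comp haarCircle id w n (integral_haarCircle_mul_left _ w) hw

theorem submodule_circle_eq_top (S : Submodule ℂ C(Circle, ℂ))
    (hS : IsClosed (S : Set C(Circle, ℂ))) (h : ∀ n, character n ∈ S) : S = ⊤ := by
  refine closed_submodule_eq_top (Set.range character) ⟨0, character_zero⟩ ?_ ?_ ?_ S hS
    (Set.range_subset_iff.2 h)
  · rintro _ ⟨m, rfl⟩ _ ⟨n, rfl⟩
    exact ⟨m + n, character_add m n⟩
  · rintro _ ⟨m, rfl⟩
    exact ⟨-m, (star_character m).symm⟩
  · intro x y hxy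
    refine ⟨_, ⟨1, rfl⟩, ?_⟩
    simpa [character_apply, Circle.ext_iff] using hxy

/-- Two continuous linear maps on `C(𝕋)` which agree on the characters are equal. -/
theorem clm_circle_ext {W : Type*} [AddCommMonoid W] [Module ℂ W] [TopologicalSpace W]
    [T2Space W] {F G : C(Circle, ℂ) →L[ℂ] W} (h : ∀ n, F (character n) = G (character n)) :
    F = G := by
  have := submodule_circle_eq_top (LinearMap.eqLocus F.toLinearMap G.toLinearMap)
    (isClosed_eq F.continuous G.continuous) h
  ext q : 1
  have hq : q ∈ LinearMap.eqLocus F.toLinearMap G.toLinearMap := this ▸ Submodule.mem_top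
  exact hq

/-- Integration of `q` against a bounded weight. -/
def integralMulCLM {Y : Type*} [TopologicalSpace Y] [CompactSpace Y] [MeasurableSpace Y]
    [BorelSpace Y] (ν : Measure Y) [IsFiniteMeasure ν] (ψ : Y → ℂ)
    (hψ : Integrable ψ ν) : C(Y, ℂ) →L[ℂ] ℂ :=
  LinearMap.mkContinuous
    { toFun := fun q => ∫ y, q y * ψ y ∂ν
      map_add' := fun p q => by
        simp only [ContinuousMap.add_apply, add_mul]
        refine integral_add ?_ ?_ <;>
        exact hψ.bdd_mul (ContinuousMap.continuous _).aestronglyMeasurable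
          (Eventually.of_forall (ContinuousMap.norm_coe_le_norm _))
      map_smul' := fun c q => by
        simp only [ContinuousMap.smul_apply, smul_eq_mul, mul_assoc, RingHom.id_apply]
        exact integral_const_mul _ _ }
    (∫ y, ‖ψ y‖ ∂ν) (fun q => by
      rw [mul_comm, ← integral_const_mul]
      refine norm_integral_le_of_norm_le (hψ.norm.const_mul _) (Eventually.of_forall fun y => ?_)
      simp only [norm_mul]
      gcongr
      exact q.norm_coe_le_norm y)

theorem integralMulCLM_apply {Y : Type*} [TopologicalSpace Y] [CompactSpace Y] [MeasurableSpace Y]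
    [BorelSpace Y] (ν : Measure Y) [IsFiniteMeasure ν] (ψ : Y → ℂ)
    (hψ : Integrable ψ ν) (q : C(Y, ℂ)) : integralMulCLM ν ψ hψ q = ∫ y, q y * ψ y ∂ν := rfl

theorem eq_zero_of_integral_mul_star {q : C(Circle, ℂ)}
    (h : ∫ z, q z * star q z ∂haarCircle = 0) : q = 0 := by
  have h1 : ∫ z, ‖q z‖ ^ 2 ∂haarCircle = 0 := by
    have : ∀ z, q z * star q z = ((‖q z‖ ^ 2 : ℝ) : ℂ) := fun z => by
      rw [ContinuousMap.star_apply]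
      simpa using Complex.mul_conj' (q z)
    simp only [this] at h
    rw [integral_complex_ofReal] at h
    exact_mod_cast h
  have hc : Continuous fun z => ‖q z‖ ^ 2 := by fun_prop
  ext z
  by_contra hz
  exact (hc.integral_pos_of_hasCompactSupport_nonneg_nonzero (μ := haarCircle) (x := z)
    (HasCompactSupport.of_compactSpace _) (fun z => by positivity) (by simpa using hz)).ne' h1

/-- Pairing with `q` vanishes on trigonometric polynomials, hence by density on `star q`, and Haar
measure has full support. -/
theorem eq_zero_of_fourier {q : C(Circle, ℂ)}
    (h : ∀ n, ∫ z, q z * character n z ∂haarCircle = 0) : q = 0 := by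
  have h0 : integralMulCLM haarCircle q (integrable_haarCircle q) = 0 :=
    clm_circle_ext fun n => by
      rw [integralMulCLM_apply, zero_apply, ← h n]
      simp only [mul_comm]
  refine eq_zero_of_integral_mul_star ?_
  have := DFunLike.congr_fun h0 (star q)
  rw [integralMulCLM_apply, zero_apply] at this
  rw [← this]
  simp only [mul_comm]

/-- The Fejér identity. -/
theorem fejer_sum (w : Circle) (N : ℕ) :
    ∑ j ∈ Finset.range N, ∑ l ∈ Finset.Icc (-(j : ℤ)) (j : ℤ), character l w
      = ((‖∑ j ∈ Finset.range N, character j w‖ ^ 2 : ℝ) : ℂ) := by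
  -- The Dirichlet kernel is the increment of the squared norm: `|s + c|² - |s|² = 1 + c s̄ + c̄ s`,
  -- with `s` the partial geometric sum and `c = w ^ N`.
  have hD : ∀ N : ℕ, ∑ l ∈ Finset.Icc (-(N : ℤ)) (N : ℤ), character l w
      = 1 + character N w * star (∑ j ∈ Finset.range N, character j w)
        + star (character N w) * (∑ j ∈ Finset.range N, character j w) := by
    intro N
    have hs : ∀ n, star (character n w) = character (-n) w := fun n => by
      rw [← star_character]; rfl
    have hm : ∀ m n, character m w * character n w = character (m + n) w := fun m n => by
      rw [character_add]; rfl
    rw [star_sum, Finset.mul_sum, Finset.mul_sum]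
    simp only [hs, hm]
    have e1 : ∑ i ∈ Finset.range N, character ((N : ℤ) + -(i : ℤ)) w
        = ∑ l ∈ Finset.Icc (1 : ℤ) N, character l w := by
      refine Finset.sum_bij (fun i _ => (N : ℤ) + -(i : ℤ)) ?_ ?_ ?_ ?_
      · intro i hi; simp at hi ⊢; omega
      · intro i _ j _ h; simpa using h
      · intro l hl
        simp at hl
        exact ⟨(N - l).toNat, by simp; omega, by omega⟩
      · intros; rfl
    have e2 : ∑ i ∈ Finset.range N, character (-(N : ℤ) + (i : ℤ)) w
        = ∑ l ∈ Finset.Icc (-(N : ℤ)) (-1), character l w := by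
      refine Finset.sum_bij (fun i _ => -(N : ℤ) + (i : ℤ)) ?_ ?_ ?_ ?_
      · intro i hi; simp at hi ⊢; omega
      · intro i _ j _ h; simpa using h
      · intro l hl
        simp at hl
        exact ⟨(N + l).toNat, by simp; omega, by omega⟩
      · intros; rfl
    rw [e1, e2]
    have hu : Finset.Icc (-(N : ℤ)) (N : ℤ)
        = insert 0 (Finset.Icc (1 : ℤ) N ∪ Finset.Icc (-(N : ℤ)) (-1)) := by
      ext l; simp; omega
    rw [hu, Finset.sum_insert (by simp), Finset.sum_union (by
      rw [Finset.disjoint_left]; intro l; simp; omega), character_zero]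
    simp [add_assoc]
  have hsq : ∀ c : ℂ, ((‖c‖ ^ 2 : ℝ) : ℂ) = c * star c := fun c => by
    simpa using (Complex.mul_conj' c).symm
  induction N with
  | zero => simp
  | succ N ih =>
    rw [Finset.sum_range_succ, ih, hD, Finset.sum_range_succ, hsq, hsq, star_add]
    have : character N w * star (character N w) = 1 := by
      rw [← hsq, character_apply, Circle.norm_coe]; simp
    linear_combination -this

/-! ### Elementary tensors in `C(X × 𝕋)` -/

/-- The function `(x, z) ↦ g(x) z ^ n`. -/
def tensor {X : Type*} [TopologicalSpace X] (g : C(X, ℂ)) (n : ℤ) : C(X × Circle, ℂ) where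
  toFun p := g p.1 * character n p.2
  continuous_toFun := by fun_prop

theorem tensor_apply {X : Type*} [TopologicalSpace X] (g : C(X, ℂ)) (n : ℤ) (p : X × Circle) :
    tensor g n p = g p.1 * character n p.2 := rfl

/-- Stone–Weierstrass: `1 ⊗ χ_1` separates points of one fibre, Urysohn functions separate distinct
fibres. -/
theorem submodule_prod_circle_eq_top {X : Type*} [TopologicalSpace X] [CompactSpace X] [T2Space X]
    (S : Submodule ℂ C(X × Circle, ℂ)) (hS : IsClosed (S : Set C(X × Circle, ℂ)))
    (h : ∀ g n, tensor g n ∈ S) : S = ⊤ := by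
  refine closed_submodule_eq_top {a | ∃ g n, a = tensor g n} ⟨1, 0, ?_⟩ ?_ ?_ ?_ S hS ?_
  · ext; simp [tensor_apply, character_zero]
  · rintro _ ⟨g, n, rfl⟩ _ ⟨g', n', rfl⟩
    refine ⟨g * g', n + n', ?_⟩
    ext p
    simp only [ContinuousMap.mul_apply, tensor_apply, character_add]
    ring
  · rintro _ ⟨g, n, rfl⟩
    refine ⟨star g, -n, ?_⟩
    ext p
    simp only [ContinuousMap.star_apply, tensor_apply, ← star_character, star_mul']
  · rintro ⟨x, z⟩ ⟨y, w⟩ hne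
    by_cases hxy : x = y
    · refine ⟨_, ⟨1, 1, rfl⟩, ?_⟩
      subst hxy
      simpa [tensor_apply, character_apply, Circle.ext_iff] using hne
    · obtain ⟨g, hg⟩ := exists_continuous_zero_one_of_isClosed (isClosed_singleton (x := x))
        (isClosed_singleton (x := y)) (by simpa using hxy)
      refine ⟨_, ⟨(⟨fun x => (g x : ℂ), by fun_prop⟩ : C(X, ℂ)), 0, rfl⟩, ?_⟩
      have h0 : g x = 0 := hg.1 rfl
      have h1 : g y = 1 := hg.2.1 rfl
      simp [tensor_apply, character_zero, h0, h1]
  · rintro _ ⟨g, n, rfl⟩; exact h g n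

/-! ### Averages of contractions -/

section Average

variable {V : Type*} [AddCommGroup V] [Module ℂ V]

/-- The arithmetic means `(1/N) ∑_{k<N} U^k`. -/
def average (U : V →ₗ[ℂ] V) (N : ℕ) : V →ₗ[ℂ] V :=
  (N : ℂ)⁻¹ • ∑ k ∈ Finset.range N, U ^ k

theorem average_apply (U : V →ₗ[ℂ] V) (N : ℕ) (v : V) :
    average U N v = (N : ℂ)⁻¹ • ∑ k ∈ Finset.range N, (U ^ k) v := by
  simp [average, LinearMap.sum_apply]

theorem average_of_fixed {U : V →ₗ[ℂ] V} {v : V} (hv : U v = v) {N : ℕ} (hN : N ≠ 0) :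
    average U N v = v := by
  have : ∀ k, (U ^ k) v = v := fun k => by
    induction k with
    | zero => rfl
    | succ k ih => rw [pow_succ, Module.End.mul_apply, hv, ih]
  have hN' : (N : ℂ) ≠ 0 := by exact_mod_cast hN
  simp [average_apply, this, ← Nat.cast_smul_eq_nsmul ℂ, smul_smul, hN']

theorem average_map_sub (U : V →ₗ[ℂ] V) (N : ℕ) (v : V) :
    average U N (U v) - average U N v = (N : ℂ)⁻¹ • ((U ^ N) v - v) := by
  rw [average_apply, average_apply, ← smul_sub, ← Finset.sum_sub_distrib]
  congr 1
  have : ∀ k, (U ^ k) (U v) = (U ^ (k + 1)) v := fun k => by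
    rw [pow_succ, Module.End.mul_apply]
  simp only [this]
  rw [Finset.sum_range_sub fun k => (U ^ k) v, pow_zero, Module.End.one_apply]

end Average

section NormedAverage

variable {V : Type*} [NormedAddCommGroup V] [NormedSpace ℂ V]

theorem norm_pow_le_of_contraction {U : V →ₗ[ℂ] V} (hU : ∀ v, ‖U v‖ ≤ ‖v‖) (k : ℕ) (v : V) :
    ‖(U ^ k) v‖ ≤ ‖v‖ := by
  induction k with
  | zero => simp
  | succ k ih => rw [pow_succ', Module.End.mul_apply]; exact (hU _).trans ih

theorem norm_average_le {U : V →ₗ[ℂ] V} (hU : ∀ v, ‖U v‖ ≤ ‖v‖) (N : ℕ) (v : V) :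
    ‖average U N v‖ ≤ ‖v‖ := by
  rw [average_apply, norm_smul, norm_inv, Complex.norm_natCast]
  rcases Nat.eq_zero_or_pos N with rfl | hN
  · simp
  rw [inv_mul_le_iff₀ (by exact_mod_cast hN)]
  refine (norm_sum_le _ _).trans ?_
  refine (Finset.sum_le_sum fun k _ => norm_pow_le_of_contraction hU k v).trans ?_
  simp

theorem tendsto_average_map_sub {U : V →ₗ[ℂ] V} (hU : ∀ v, ‖U v‖ ≤ ‖v‖) (v : V) :
    Tendsto (fun N => average U N (U v) - average U N v) atTop (𝓝 0) := by
  have h : Tendsto (fun N : ℕ => (N : ℝ)⁻¹ * (2 * ‖v‖)) atTop (𝓝 0) := by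
    simpa using (tendsto_inv_atTop_nhds_zero_nat (𝕜 := ℝ)).mul_const (2 * ‖v‖)
  refine squeeze_zero_norm (fun N => ?_) h
  rw [average_map_sub, norm_smul, norm_inv, Complex.norm_natCast]
  gcongr
  linarith [norm_sub_le ((U ^ N) v) v, norm_pow_le_of_contraction hU N v]

/-- `U` commutes with its averages, and the averages of `U v - v` telescope to size `O(1/N)`. -/
theorem average_fixed_of_tendsto {U : V →ₗ[ℂ] V} (hU : ∀ v, ‖U v‖ ≤ ‖v‖) {v w : V}
    (h : Tendsto (fun N => average U N v) atTop (𝓝 w)) : U w = w := by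
  have hc : Continuous U := (U.mkContinuous 1 (by simpa using hU)).continuous
  have h1 : Tendsto (fun N => U (average U N v)) atTop (𝓝 (U w)) := (hc.tendsto w).comp h
  have h2 : ∀ N, U (average U N v) = average U N (U v) := fun N => by
    rw [average_apply, average_apply, map_smul, map_sum]
    congr 1
    refine Finset.sum_congr rfl fun k _ => ?_
    rw [← Module.End.mul_apply, ← Module.End.mul_apply, ← pow_succ', pow_succ]
  simp only [h2] at h1
  have h3 := h1.sub h
  exact sub_eq_zero.1 (tendsto_nhds_unique h3 (tendsto_average_map_sub hU v))

end NormedAverage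

/-! ### Ultrafilter limits of functionals -/

/-- Closed balls of `ℂ` are compact, so one ultrafilter serves all vectors at once, without
separability of `V`. -/
theorem exists_ultrafilter_limit {V : Type*} [NormedAddCommGroup V] [NormedSpace ℂ V]
    (L : ℕ → V →ₗ[ℂ] ℂ) (hL : ∀ N v, ‖L N v‖ ≤ ‖v‖) (F : Ultrafilter ℕ) :
    ∃ φ : V →ₗ[ℂ] ℂ, ∀ v, Tendsto (fun N => L N v) F (𝓝 (φ v)) := by
  have h : ∀ v, ∃ c, Tendsto (fun N => L N v) F (𝓝 c) := fun v => by
    obtain ⟨c, _, hc⟩ := (isCompact_closedBall (0 : ℂ) ‖v‖).ultrafilter_le_nhds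
      (F.map fun N => L N v) (by
        rw [le_principal_iff]
        exact Eventually.of_forall (f := (F : Filter ℕ))
          (p := fun N => L N v ∈ Metric.closedBall 0 ‖v‖) fun N => by simpa using hL N v)
    exact ⟨c, hc⟩
  choose φ hφ using h
  refine ⟨{ toFun := φ, map_add' := fun v w => ?_, map_smul' := fun c v => ?_ }, hφ⟩
  · refine tendsto_nhds_unique (hφ (v + w)) ?_
    simpa using (hφ v).add (hφ w)
  · refine tendsto_nhds_unique (hφ (c • v)) ?_
    simpa using (hφ v).const_mul c

/-- Failure of uniform convergence leaves points with `‖B N (x N)‖ ≥ ε/2` for infinitely many `N`,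
and the ultrafilter is chosen on those indices. Sup-norm convergence thus becomes a question about
limits of point evaluations. -/
theorem exists_ultrafilter_of_not_tendsto {X : Type*} [TopologicalSpace X] [CompactSpace X]
    {B : ℕ → C(X, ℂ)} (h : ¬ Tendsto B atTop (𝓝 0)) :
    ∃ F : Ultrafilter ℕ, (F : Filter ℕ) ≤ atTop ∧ ∃ x : ℕ → X,
      ¬ Tendsto (fun N => B N (x N)) F (𝓝 0) := by
  rw [Metric.tendsto_atTop] at h
  push Not at h
  obtain ⟨ε, hε, h⟩ := h
  have hfr : ∃ᶠ N in atTop, ε ≤ dist (B N) 0 := Filter.frequently_atTop.2 h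
  have hx : ∀ N, ε ≤ dist (B N) 0 → ∃ x, ε / 2 ≤ ‖B N x‖ := fun N hN => by
    by_contra hcon
    push Not at hcon
    rw [dist_zero_right] at hN
    have := (ContinuousMap.norm_le (B N) (half_pos hε).le).2 fun x => (hcon x).le
    linarith
  obtain ⟨N₀, hN₀⟩ := hfr.exists
  obtain ⟨x₀, _⟩ := hx N₀ hN₀
  have hx' : ∀ N, ∃ x, ε ≤ dist (B N) 0 → ε / 2 ≤ ‖B N x‖ := fun N => by
    by_cases hN : ε ≤ dist (B N) 0
    · obtain ⟨x, hx⟩ := hx N hN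
      exact ⟨x, fun _ => hx⟩
    · exact ⟨x₀, fun h => absurd h hN⟩
  choose x hx using hx'
  have : NeBot (atTop ⊓ 𝓟 {N | ε ≤ dist (B N) 0}) := Filter.frequently_mem_iff_neBot.1 hfr
  refine ⟨Ultrafilter.of (atTop ⊓ 𝓟 {N | ε ≤ dist (B N) 0}),
    (Ultrafilter.of_le _).trans inf_le_left, x, fun ht => ?_⟩
  have h1 : ∀ᶠ N in (Ultrafilter.of (atTop ⊓ 𝓟 {N | ε ≤ dist (B N) 0}) : Filter ℕ),
      ε / 2 ≤ ‖B N (x N)‖ :=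
    Filter.mem_of_superset (((Ultrafilter.of_le _).trans inf_le_right) (mem_principal_self _)) hx
  have h3 := ge_of_tendsto ht.norm h1
  rw [norm_zero] at h3
  linarith

/-! ### The twisted Koopman operators on `C(X)` -/

section Twist

variable {X : Type*} [TopologicalSpace X]

/-- The operator `g ↦ (g ∘ θ) f ^ n` on `C(X)`. -/
def twist (θ : X ≃ₜ X) (f : C(X, Circle)) (n : ℤ) : C(X, ℂ) →ₗ[ℂ] C(X, ℂ) where
  toFun g := ⟨fun x => g (θ x) * character n (f x), by fun_prop⟩
  map_add' g h := by ext x; simp [add_mul]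
  map_smul' c g := by ext x; simp [mul_assoc]

theorem twist_apply (θ : X ≃ₜ X) (f : C(X, Circle)) (n : ℤ) (g : C(X, ℂ)) (x : X) :
    twist θ f n g x = g (θ x) * character n (f x) := rfl

theorem norm_character (n : ℤ) (z : Circle) : ‖character n z‖ = 1 := Circle.norm_coe _

theorem norm_twist_le [CompactSpace X] (θ : X ≃ₜ X) (f : C(X, Circle)) (n : ℤ) (g : C(X, ℂ)) :
    ‖twist θ f n g‖ ≤ ‖g‖ := by
  rw [ContinuousMap.norm_le _ (norm_nonneg _)]
  intro x
  rw [twist_apply, norm_mul, norm_character, mul_one]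
  exact g.norm_coe_le_norm _

theorem norm_twist_pow_apply (θ : X ≃ₜ X) (f : C(X, Circle)) (n : ℤ) (k : ℕ) (g : C(X, ℂ))
    (x : X) : ‖(twist θ f n ^ k) g x‖ = ‖g (θ^[k] x)‖ := by
  induction k generalizing g with
  | zero => rfl
  | succ k ih =>
    rw [pow_succ, Module.End.mul_apply, ih, twist_apply, norm_mul, norm_character, mul_one,
      Function.iterate_succ_apply']

theorem twist_zero_pow_apply (θ : X ≃ₜ X) (f : C(X, Circle)) (k : ℕ) (g : C(X, ℂ))
    (x : X) : (twist θ f 0 ^ k) g x = g (θ^[k] x) := by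
  induction k generalizing g with
  | zero => rfl
  | succ k ih =>
    rw [pow_succ, Module.End.mul_apply, ih, twist_apply, character_zero, ContinuousMap.one_apply,
      mul_one, Function.iterate_succ_apply']

theorem average_twist_apply (θ : X ≃ₜ X) (f : C(X, Circle)) (n : ℤ) (N : ℕ) (g : C(X, ℂ)) (x : X) :
    average (twist θ f n) N g x = (N : ℂ)⁻¹ * ∑ k ∈ Finset.range N, (twist θ f n ^ k) g x := by
  rw [average_apply]
  simp

/-- The function `x ↦ ‖g x‖`, as a complex function. -/
def normMap (g : C(X, ℂ)) : C(X, ℂ) := ⟨fun x => (‖g x‖ : ℂ), by fun_prop⟩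

/-- The factors `f ^ n` have modulus one. This domination later gives limits of twisted averages
their `L¹` bound. -/
theorem norm_average_twist_apply_le (θ : X ≃ₜ X) (f : C(X, Circle)) (n : ℤ) (N : ℕ)
    (g : C(X, ℂ)) (x : X) :
    ‖average (twist θ f n) N g x‖ ≤ ‖average (twist θ f 0) N (normMap g) x‖ := by
  rw [average_twist_apply, average_twist_apply, norm_mul, norm_mul]
  gcongr
  refine (norm_sum_le _ _).trans ?_
  simp only [norm_twist_pow_apply, twist_zero_pow_apply, normMap, ContinuousMap.coe_mk]
  rw [← Complex.ofReal_sum, Complex.norm_real]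
  exact le_abs_self _

end Twist

/-! ### Unique ergodicity -/

section UniqueErgodicity

variable {X : Type*} [TopologicalSpace X] [CompactSpace X] [T2Space X]
  [MeasurableSpace X] [BorelSpace X] {θ : X ≃ₜ X} {μ : Measure X}

theorem integrable_continuousMap {Y : Type*} [TopologicalSpace Y] [CompactSpace Y]
    [MeasurableSpace Y] [BorelSpace Y] (ν : Measure Y) [IsFiniteMeasure ν] (q : C(Y, ℂ)) :
    Integrable q ν :=
  q.continuous.integrable_of_hasCompactSupport (HasCompactSupport.of_compactSpace _)

theorem IsUniqueInvariantMeasure.measurePreserving (hμ : IsUniqueInvariantMeasure θ μ) :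
    MeasurePreserving θ μ μ := ⟨θ.measurable, hμ.invariant⟩

/-- Evaluation of the `N`-th average at a point. -/
def averageAt (θ : X ≃ₜ X) (f : C(X, Circle)) (n : ℤ) (x : ℕ → X) (N : ℕ) : C(X, ℂ) →ₗ[ℂ] ℂ :=
  (ContinuousMap.evalCLM ℂ (x N)).toLinearMap ∘ₗ average (twist θ f n) N

theorem averageAt_apply (θ : X ≃ₜ X) (f : C(X, Circle)) (n : ℤ) (x : ℕ → X) (N : ℕ) (g : C(X, ℂ)) :
    averageAt θ f n x N g = average (twist θ f n) N g (x N) := rfl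

theorem norm_averageAt_le (θ : X ≃ₜ X) (f : C(X, Circle)) (n : ℤ) (x : ℕ → X) (N : ℕ)
    (g : C(X, ℂ)) : ‖averageAt θ f n x N g‖ ≤ ‖g‖ :=
  (ContinuousMap.norm_coe_le_norm _ _).trans (norm_average_le (norm_twist_le θ f n) N g)

theorem averageAt_limit_invariant {f : C(X, Circle)} {n : ℤ} {x : ℕ → X} {F : Ultrafilter ℕ}
    (hF : (F : Filter ℕ) ≤ atTop) {φ : C(X, ℂ) →ₗ[ℂ] ℂ}
    (hφ : ∀ g, Tendsto (fun N => averageAt θ f n x N g) F (𝓝 (φ g))) (g : C(X, ℂ)) :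
    φ (twist θ f n g) = φ g := by
  have h1 := (hφ (twist θ f n g)).sub (hφ g)
  have h2 : Tendsto (fun N => averageAt θ f n x N (twist θ f n g) - averageAt θ f n x N g) F
      (𝓝 0) := by
    have h := ((tendsto_average_map_sub (norm_twist_le θ f n) g).mono_left hF).norm
    rw [norm_zero] at h
    refine squeeze_zero_norm (fun N => ?_) h
    rw [averageAt_apply, averageAt_apply, ← ContinuousMap.sub_apply]
    exact ContinuousMap.norm_coe_le_norm _ (x N)
  exact sub_eq_zero.1 (tendsto_nhds_unique h1 h2)

/-- The limit is a positive, unital, invariant functional, so its Riesz–Markov measure is an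
invariant regular probability measure, which can only be `μ`. -/
theorem averageAt_limit_eq_integral (hμ : IsUniqueInvariantMeasure θ μ) {f : C(X, Circle)}
    {x : ℕ → X} {F : Ultrafilter ℕ}
    (hF : (F : Filter ℕ) ≤ atTop) {φ : C(X, ℂ) →ₗ[ℂ] ℂ}
    (hφ : ∀ g, Tendsto (fun N => averageAt θ f 0 x N g) F (𝓝 (φ g))) (g : C(X, ℂ)) :
    φ g = ∫ y, g y ∂μ := by
  let R : C(X, ℝ) →ₗ[ℝ] C(X, ℂ) :=
    { toFun := fun r => ⟨fun x => (r x : ℂ), by fun_prop⟩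
      map_add' := fun r s => by ext; simp
      map_smul' := fun r s => by ext; simp }
  have hR : ∀ r y, R r y = (r y : ℂ) := fun _ _ => rfl
  have hav : ∀ r N, averageAt θ f 0 x N (R r)
      = (((N : ℝ)⁻¹ * ∑ k ∈ Finset.range N, r (θ^[k] (x N)) : ℝ) : ℂ) := fun r N => by
    rw [averageAt_apply, average_twist_apply]
    simp only [twist_zero_pow_apply, hR]
    push_cast; rfl
  have him : ∀ r, (φ (R r)).im = 0 := fun r => by
    refine tendsto_nhds_unique ((Complex.continuous_im.tendsto _).comp (hφ (R r))) ?_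
    simp only [Function.comp_def, hav, Complex.ofReal_im]
    exact tendsto_const_nhds
  have hpos : ∀ r : C(X, ℝ), (∀ y, 0 ≤ r y) → 0 ≤ (φ (R r)).re := fun r hr => by
    refine ge_of_tendsto' ((Complex.continuous_re.tendsto _).comp (hφ (R r))) fun N => ?_
    simp only [Function.comp_def, hav, Complex.ofReal_re]
    have := Finset.sum_nonneg fun k (_ : k ∈ Finset.range N) => hr (θ^[k] (x N))
    positivity
  let Λ : CompactlySupportedContinuousMap X ℝ →ₚ[ℝ] ℝ :=
    { toFun := fun r => (φ (R r.toContinuousMap)).re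
      map_add' := fun r s => by
        rw [← Complex.add_re, ← map_add, ← map_add]; rfl
      map_smul' := fun c r => by
        have : R (c • r).toContinuousMap = (c : ℂ) • R r.toContinuousMap := by
          ext; simp [hR]
        rw [this, map_smul]; simp
      monotone' := fun r s hrs => by
        have := hpos (s.toContinuousMap - r.toContinuousMap) fun y => sub_nonneg.2 (hrs y)
        rw [map_sub, map_sub, Complex.sub_re] at this
        exact sub_nonneg.1 this }
  have hΛ : ∀ r : C(X, ℝ), ∫ y, r y ∂(RealRMK.rieszMeasure Λ) = (φ (R r)).re := fun r =>
    RealRMK.integral_rieszMeasure Λ ⟨r, HasCompactSupport.of_compactSpace _⟩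
  have h_one : φ (R 1) = 1 := by
    refine tendsto_nhds_unique (hφ (R 1)) ?_
    refine (tendsto_congr' ?_).1 tendsto_const_nhds
    filter_upwards [hF (eventually_gt_atTop 0)] with N hN
    rw [hav]
    have : (N : ℂ) ≠ 0 := by exact_mod_cast hN.ne'
    simp [this]
  have hprob : IsProbabilityMeasure (RealRMK.rieszMeasure Λ) := by
    constructor
    have := hΛ 1
    rw [h_one] at this
    simpa [Measure.real, ENNReal.toReal_eq_one_iff] using this
  have hmap : (RealRMK.rieszMeasure Λ).map θ = RealRMK.rieszMeasure Λ := by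
    have : ((RealRMK.rieszMeasure Λ).map θ).Regular := Measure.Regular.map θ
    refine Measure.ext_of_integral_eq_on_compactlySupported fun r => ?_
    rw [θ.measurableEmbedding.integral_map]
    have h1 := hΛ (r.toContinuousMap.comp ⟨θ, θ.continuous⟩)
    have h2 := hΛ r.toContinuousMap
    refine h1.trans (Eq.trans ?_ h2.symm)
    rw [← averageAt_limit_invariant hF hφ (R r.toContinuousMap)]
    congr 2
    ext y
    simp [twist_apply, hR, character_zero]
  have hν := hμ.unique _ hprob inferInstance hmap
  have hreal : ∀ r, φ (R r) = ∫ y, R r y ∂μ := fun r => by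
    simp only [hR]
    rw [integral_complex_ofReal, ← hν, hΛ]
    exact Complex.ext (by simp) (by simp [him])
  have := hμ.isProbabilityMeasure
  have hg : g = R ⟨fun y => (g y).re, by fun_prop⟩
      + Complex.I • R ⟨fun y => (g y).im, by fun_prop⟩ := by
    ext y
    simp only [ContinuousMap.add_apply, ContinuousMap.smul_apply, hR, ContinuousMap.coe_mk,
      smul_eq_mul]
    rw [mul_comm]; exact (Complex.re_add_im _).symm
  rw [hg, map_add, map_smul, hreal, hreal]
  rw [← integral_smul]
  exact (integral_add (integrable_continuousMap μ _)
    ((integrable_continuousMap μ _).smul Complex.I)).symm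

/-- Convergence is uniform because the evaluation points may move with `N`: every ultrafilter limit
of such evaluations is still integration against `μ`. -/
theorem tendsto_average_twist_zero (hμ : IsUniqueInvariantMeasure θ μ) (f : C(X, Circle))
    (g : C(X, ℂ)) : Tendsto (fun N => average (twist θ f 0) N g) atTop
      (𝓝 (ContinuousMap.const X (∫ y, g y ∂μ))) := by
  rw [← tendsto_sub_nhds_zero_iff]
  by_contra hcon
  obtain ⟨F, hF, x, hx⟩ := exists_ultrafilter_of_not_tendsto hcon
  obtain ⟨φ, hφ⟩ := exists_ultrafilter_limit (averageAt θ f 0 x) (norm_averageAt_le θ f 0 x) F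
  refine hx ?_
  have := (hφ g).sub_const (∫ y, g y ∂μ)
  rwa [averageAt_limit_eq_integral hμ hF hφ, sub_self] at this

/-- An invariant function equals its own averages, whose limit is constant. This holds at every
point, also off the support of `μ`. -/
theorem eq_integral_of_invariant (hμ : IsUniqueInvariantMeasure θ μ) {g : C(X, ℂ)}
    (hg : ∀ x, g (θ x) = g x) (x : X) : g x = ∫ y, g y ∂μ := by
  have h1 := tendsto_average_twist_zero hμ 1 g
  have h2 : Tendsto (fun N => average (twist θ 1 0) N g) atTop (𝓝 g) := by
    refine (tendsto_congr' ?_).1 tendsto_const_nhds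
    filter_upwards [eventually_ne_atTop 0] with N hN
    refine (average_of_fixed ?_ hN).symm
    ext y
    simp [twist_apply, character_zero, hg]
  exact DFunLike.congr_fun (tendsto_nhds_unique h2 h1) x

/-- Conditioning `μ` on an invariant set of positive measure gives another invariant regular
probability measure, so it is `μ` and the set is conull. -/
theorem IsUniqueInvariantMeasure.ergodic (hμ : IsUniqueInvariantMeasure θ μ) : Ergodic θ μ := by
  have := hμ.isProbabilityMeasure
  have := hμ.regular
  refine { hμ.measurePreserving with aeconst_set := fun s hs hinv => ?_ }
  rw [Filter.eventuallyConst_set']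
  by_cases h0 : μ s = 0
  · exact Or.inl (ae_eq_empty.2 h0)
  right
  have hreg : (ProbabilityTheory.cond μ s).Regular := by
    unfold ProbabilityTheory.cond
    exact Measure.Regular.smul (by simp [h0])
  have hmap : (ProbabilityTheory.cond μ s).map θ = ProbabilityTheory.cond μ s := by
    refine Measure.ext fun t ht => ?_
    rw [Measure.map_apply θ.measurable ht, ProbabilityTheory.cond_apply hs,
      ProbabilityTheory.cond_apply hs]
    rw [← hμ.measurePreserving.measure_preimage (hs.inter ht).nullMeasurableSet,
      Set.preimage_inter, hinv]
  have := hμ.unique _ (ProbabilityTheory.cond_isProbabilityMeasure h0) hreg hmap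
  rw [ae_eq_univ, ← this, ProbabilityTheory.cond_apply hs]
  simp

end UniqueErgodicity

/-! ### Square-integrable densities -/

section L2

variable {X : Type*} [TopologicalSpace X] [CompactSpace X] [T2Space X]
  [MeasurableSpace X] [BorelSpace X] {θ : X ≃ₜ X} {μ : Measure X}

theorem inner_toLp_continuousMap [IsFiniteMeasure μ] {H : X → ℂ}
    (hH : MemLp H 2 μ) (g : C(X, ℂ)) :
    inner ℂ (hH.toLp H) (ContinuousMap.toLp 2 μ ℂ g) = ∫ x, g x * star (H x) ∂μ := by
  rw [L2.inner_def]
  refine integral_congr_ae ?_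
  filter_upwards [hH.coeFn_toLp, ContinuousMap.coeFn_toLp (p := 2) (𝕜 := ℂ) μ g] with x h1 h2
  rw [h1, h2]
  simp

theorem ae_eq_zero_of_integral_continuous [IsFiniteMeasure μ] [μ.Regular] {H : X → ℂ}
    (hH : MemLp H 2 μ) (h : ∀ g : C(X, ℂ), ∫ x, g x * H x ∂μ = 0) : H =ᵐ[μ] 0 := by
  have hs : MemLp (fun x => star (H x)) 2 μ := hH.star
  have h0 : hs.toLp _ = 0 := by
    refine (ContinuousMap.toLp_denseRange ℂ μ ℂ (p := 2) (by simp)).eq_zero_of_inner_left ℂ fun g => ?_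
    rw [inner_toLp_continuousMap]
    simpa using h g
  have h1 := hs.coeFn_toLp
  rw [h0] at h1
  filter_upwards [h1, Lp.coeFn_zero ℂ 2 μ] with x hx hx0
  rw [hx0] at hx
  simpa using hx.symm

theorem integral_norm_le_norm_toLp [IsProbabilityMeasure μ] (g : C(X, ℂ)) :
    ∫ x, ‖g x‖ ∂μ ≤ ‖ContinuousMap.toLp (E := ℂ) 2 μ ℂ g‖ := by
  have hg : AEStronglyMeasurable g μ := g.continuous.aestronglyMeasurable
  rw [Lp.norm_def, eLpNorm_congr_ae (ContinuousMap.coeFn_toLp (p := 2) (𝕜 := ℂ) μ g),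
    integral_norm_eq_lintegral_enorm hg, ← eLpNorm_one_eq_lintegral_enorm]
  refine ENNReal.toReal_mono ?_ (eLpNorm_le_eLpNorm_of_exponent_le (by norm_num) hg)
  exact (memLp_top_of_bound hg ‖g‖ (Eventually.of_forall g.norm_coe_le_norm)).mono_exponent
    le_top |>.eLpNorm_ne_top

/-- A functional dominated by the `L¹`-norm has a square-integrable density. -/
theorem exists_density [IsProbabilityMeasure μ] [μ.Regular] (φ : C(X, ℂ) →ₗ[ℂ] ℂ)
    (hφ : ∀ g, ‖φ g‖ ≤ ∫ x, ‖g x‖ ∂μ) :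
    ∃ H : X → ℂ, MemLp H 2 μ ∧ ∀ g, φ g = ∫ x, g x * H x ∂μ := by
  let e : C(X, ℂ) →ₗ[ℂ] Lp ℂ 2 μ := (ContinuousMap.toLp (E := ℂ) 2 μ ℂ).toLinearMap
  have hd : DenseRange e := ContinuousMap.toLp_denseRange ℂ μ ℂ (by simp)
  have hb : ∀ g, ‖φ g‖ ≤ 1 * ‖e g‖ := fun g => by
    rw [one_mul]; exact (hφ g).trans (integral_norm_le_norm_toLp g)
  -- The `L¹` bound gives an `L²` bound since `μ` is a probability measure, so the functional
  -- extends to `L²` and is represented by `ρ`. The density is `star ρ`, the inner product being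
  -- conjugate-linear on the left.
  let ρ : Lp ℂ 2 μ := (InnerProductSpace.toDual ℂ (Lp ℂ 2 μ)).symm (φ.extendOfNorm e)
  refine ⟨fun x => star (ρ x), (Lp.memLp ρ).star, fun g => ?_⟩
  rw [← LinearMap.extendOfNorm_eq hd ⟨1, hb⟩ g, ← InnerProductSpace.toDual_symm_apply]
  have := inner_toLp_continuousMap (Lp.memLp ρ) g
  rwa [Lp.toLp_coeFn] at this

end L2

/-! ### Unitary solutions of the cohomological equations -/

section Solutions

variable {X : Type*} [TopologicalSpace X] [CompactSpace X] [T2Space X]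
  [MeasurableSpace X] [BorelSpace X] {θ : X ≃ₜ X} {μ : Measure X}

/-- A measurable unitary solution of the cohomological equation. -/
structure IsUnitarySolution (θ : X ≃ₜ X) (μ : Measure X) (f : C(X, Circle)) (n : ℤ)
    (w : X → Circle) : Prop where
  measurable : Measurable w
  ae_eq : ∀ᵐ x ∂μ, w (θ x) * f x ^ n = w x

theorem IsUnitarySolution.mul {f : C(X, Circle)} {m n : ℤ} {w w' : X → Circle}
    (h : IsUnitarySolution θ μ f m w) (h' : IsUnitarySolution θ μ f n w') :
    IsUnitarySolution θ μ f (m + n) (w * w') := by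
  refine ⟨h.measurable.mul h'.measurable, ?_⟩
  filter_upwards [h.ae_eq, h'.ae_eq] with x hx hx'
  rw [Pi.mul_apply, Pi.mul_apply, ← hx, ← hx', zpow_add]
  exact mul_mul_mul_comm _ _ _ _

theorem IsUnitarySolution.inv {f : C(X, Circle)} {n : ℤ} {w : X → Circle}
    (h : IsUnitarySolution θ μ f n w) : IsUnitarySolution θ μ f (-n) w⁻¹ := by
  refine ⟨h.measurable.inv, ?_⟩
  filter_upwards [h.ae_eq] with x hx
  rw [Pi.inv_apply, Pi.inv_apply, ← hx, zpow_neg, mul_inv]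

theorem IsUnitarySolution.zpow {f : C(X, Circle)} {n : ℤ} {w : X → Circle}
    (h : IsUnitarySolution θ μ f n w) (l : ℤ) :
    IsUnitarySolution θ μ f (l * n) (fun x => w x ^ l) := by
  refine ⟨(continuous_zpow l).measurable.comp h.measurable, ?_⟩
  filter_upwards [h.ae_eq] with x hx
  rw [← hx, mul_zpow, ← zpow_mul, mul_comm l]

/-- The levels at which there are measurable solutions. -/
def measurableLevels (θ : X ≃ₜ X) (μ : Measure X) (f : C(X, Circle)) : AddSubgroup ℤ where
  carrier := {n | ∃ w, IsUnitarySolution θ μ f n w}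
  zero_mem' := ⟨1, measurable_const, by simp⟩
  add_mem' := by rintro m n ⟨w, hw⟩ ⟨w', hw'⟩; exact ⟨_, hw.mul hw'⟩
  neg_mem' := by rintro n ⟨w, hw⟩; exact ⟨_, hw.inv⟩

/-- The levels at which there are continuous solutions. -/
def continuousLevels (θ : X ≃ₜ X) (f : C(X, Circle)) : AddSubgroup ℤ where
  carrier := {n | ∃ w : C(X, Circle), ∀ x, w (θ x) * f x ^ n = w x}
  zero_mem' := ⟨1, by simp⟩
  add_mem' := by
    rintro m n ⟨w, hw⟩ ⟨w', hw'⟩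
    refine ⟨w * w', fun x => ?_⟩
    rw [ContinuousMap.mul_apply, ContinuousMap.mul_apply, ← hw x, ← hw' x, zpow_add]
    exact mul_mul_mul_comm _ _ _ _
  neg_mem' := by
    rintro n ⟨w, hw⟩
    refine ⟨w⁻¹, fun x => ?_⟩
    rw [ContinuousMap.inv_apply, ContinuousMap.inv_apply, ← hw x, zpow_neg, mul_inv]

theorem isUnitarySolution_of_continuous {f : C(X, Circle)} {n : ℤ} {w : C(X, Circle)}
    (h : ∀ x, w (θ x) * f x ^ n = w x) : IsUnitarySolution θ μ f n w :=
  ⟨w.continuous.measurable, Eventually.of_forall h⟩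

/-- The quotient `w / w'` is invariant, hence constant by ergodicity. -/
theorem IsUnitarySolution.ae_eq_const_mul (hμ : IsUniqueInvariantMeasure θ μ) {f : C(X, Circle)}
    {n : ℤ} {w w' : X → Circle} (h : IsUnitarySolution θ μ f n w)
    (h' : IsUnitarySolution θ μ f n w') : ∃ c : Circle, ∀ᵐ x ∂μ, w x = c * w' x := by
  have hm := h.mul h'.inv
  obtain ⟨c, hc⟩ := hμ.ergodic.ae_eq_const_of_ae_eq_comp_ae hm.measurable.aestronglyMeasurable
    (by filter_upwards [hm.ae_eq] with x hx; simpa using hx)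
  refine ⟨c, ?_⟩
  filter_upwards [hc] with x hx
  have hc' : c = w x * (w' x)⁻¹ := hx.symm
  rw [hc', inv_mul_cancel_right]

/-- The modulus of `g` is invariant, so ergodicity makes it a constant `r`; if `r ≠ 0`, the phase of
`g` is the unitary solution. -/
theorem ae_eq_zero_or_unitary (hμ : IsUniqueInvariantMeasure θ μ) {f : C(X, Circle)} {n : ℤ}
    {g : X → ℂ} (hg : AEStronglyMeasurable g μ)
    (h : ∀ᵐ x ∂μ, g (θ x) * ((f x ^ n : Circle) : ℂ) = g x) :
    g =ᵐ[μ] 0 ∨ ∃ c : ℂ, c ≠ 0 ∧ ∃ w, IsUnitarySolution θ μ f n w ∧ ∀ᵐ x ∂μ, g x = c * w x := by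
  obtain ⟨r, hr⟩ := hμ.ergodic.ae_eq_const_of_ae_eq_comp_ae hg.norm (by
    filter_upwards [h] with x hx
    rw [← hx, norm_mul, Circle.norm_coe, mul_one]; rfl)
  by_cases h0 : r = 0
  · left
    filter_upwards [hr] with x hx
    simpa [h0] using hx
  right
  -- The phase is taken from a strongly measurable representative, because `IsUnitarySolution` asks
  -- for genuine measurability.
  have hgm := hg.ae_eq_mk
  have hw : ∀ᵐ x ∂μ, g x = (r : ℂ) * (Circle.exp (Complex.arg (hg.mk g x)) : ℂ) := by
    filter_upwards [hgm, hr] with x h1 h2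
    rw [← h1, Circle.coe_exp]
    have : r = ‖g x‖ := h2.symm
    rw [this, Complex.norm_mul_exp_arg_mul_I]
  have hr0 : (r : ℂ) ≠ 0 := by exact_mod_cast h0
  refine ⟨r, hr0, fun x => Circle.exp (Complex.arg (hg.mk g x)),
    ⟨Circle.exp.continuous.measurable.comp
      (Complex.measurable_arg.comp hg.stronglyMeasurable_mk.measurable), ?_⟩, hw⟩
  filter_upwards [h, hw, hμ.measurePreserving.quasiMeasurePreserving.ae hw] with x h1 h2 h3
  rw [h2, h3, mul_assoc] at h1
  exact Circle.ext (by simpa using mul_left_cancel₀ hr0 h1)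

/-- Here the modulus is continuous and invariant, so it is constant at every point and there is no
exceptional set. -/
theorem eq_zero_or_continuous_unitary (hμ : IsUniqueInvariantMeasure θ μ) {f : C(X, Circle)} {n : ℤ}
    {G : C(X, ℂ)} (h : IsContinuousSolution θ f n G) :
    G = 0 ∨ ∃ c : ℂ, c ≠ 0 ∧ ∃ w : C(X, Circle), (∀ x, w (θ x) * f x ^ n = w x) ∧
      ∀ x, G x = c * w x := by
  have hn : ∀ x, (‖G x‖ : ℂ) = ∫ y, normMap G y ∂μ :=
    eq_integral_of_invariant hμ (g := normMap G) fun x => by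
      simp only [normMap, ContinuousMap.coe_mk]
      rw [← h x, norm_mul, Circle.norm_coe, mul_one]
  set r := ∫ y, normMap G y ∂μ
  by_cases h0 : r = 0
  · left
    ext x
    simpa [h0] using hn x
  right
  have hG : ∀ x, G x ≠ 0 := fun x hx => h0 (by rw [← hn x, hx]; simp)
  have hu : ∀ x, G x / r ∈ Submonoid.unitSphere ℂ := fun x => by
    rw [← hn x]
    simp [Submonoid.unitSphere, hG x]
  let w : C(X, Circle) := ⟨fun x => ⟨G x / r, hu x⟩, by fun_prop⟩
  have hw : ∀ x, ((w x : Circle) : ℂ) = G x / r := fun _ => rfl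
  refine ⟨r, h0, w, fun x => Circle.ext ?_, fun x => ?_⟩
  · rw [Circle.coe_mul, hw, hw, ← h x]; ring
  · rw [hw]; field_simp

theorem continuous_solution_unique (hμ : IsUniqueInvariantMeasure θ μ) {f : C(X, Circle)} {n : ℤ}
    {G : C(X, ℂ)} (hG : IsContinuousSolution θ f n G) {w : C(X, Circle)}
    (hw : ∀ x, w (θ x) * f x ^ n = w x) (x : X) :
    G x = (∫ y, G y * ((w y)⁻¹ : Circle) ∂μ) * w x := by
  have := eq_integral_of_invariant hμ (g := ⟨fun x => G x * ((w x)⁻¹ : Circle), by fun_prop⟩)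
    (fun x => by
      simp only [ContinuousMap.coe_mk]
      rw [← hG x, ← hw x, mul_inv, Circle.coe_mul, Circle.coe_inv (f x ^ n)]
      have : ((f x ^ n : Circle) : ℂ) ≠ 0 := Circle.coe_ne_zero _
      field_simp) x
  simp only [ContinuousMap.coe_mk] at this
  rw [← this, Circle.coe_inv, inv_mul_cancel_right₀ (Circle.coe_ne_zero _)]

/-- Subgroups of `ℤ` are cyclic. The trivial one fits because `sInf ∅ = 0` and `0` divides only `0`.
-/
theorem sInf_addSubgroup_dvd_iff (H : AddSubgroup ℤ) (n : ℤ) :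
    ((sInf {m : ℕ | 0 < m ∧ (m : ℤ) ∈ H} : ℕ) : ℤ) ∣ n ↔ n ∈ H := by
  obtain ⟨a, rfl⟩ := Int.subgroup_cyclic H
  have hmem : ∀ n, n ∈ AddSubgroup.closure {a} ↔ a ∣ n := fun n => by
    rw [← AddSubgroup.zmultiples_eq_closure, Int.mem_zmultiples_iff]
  rw [hmem]
  simp only [hmem]
  have : sInf {m : ℕ | 0 < m ∧ a ∣ (m : ℤ)} = a.natAbs := by
    by_cases ha : a = 0
    · subst ha
      have : {m : ℕ | 0 < m ∧ (0 : ℤ) ∣ (m : ℤ)} = ∅ := by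
        ext m; simp; omega
      rw [this]; simp
    · refine le_antisymm (Nat.sInf_le ⟨by omega, by simp⟩) ?_
      refine le_csInf ⟨a.natAbs, by omega, by simp⟩ ?_
      rintro m ⟨hm, hd⟩
      exact Nat.le_of_dvd hm (Int.natAbs_dvd_natAbs.2 hd)
  rw [this, Int.natAbs_dvd]

theorem IsUnitarySolution.exists_Lp [IsFiniteMeasure μ] [NeZero μ]
    (hθ : MeasurePreserving θ μ μ) {f : C(X, Circle)} {n : ℤ}
    {w : X → Circle} (h : IsUnitarySolution θ μ f n w) :
    ∃ g : Lp ℂ ∞ μ, IsMeasurableSolution θ μ f n g ∧ (∀ᵐ x ∂μ, g x = w x) ∧ g ≠ 0 := by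
  have hm := memLp_comp μ ⟨((↑) : Circle → ℂ), continuous_subtype_val⟩ h.measurable
  have hc : ∀ᵐ x ∂μ, hm.toLp _ x = w x := hm.coeFn_toLp
  refine ⟨hm.toLp _, ?_, hc, fun h0 => ?_⟩
  · filter_upwards [h.ae_eq, hc, hθ.quasiMeasurePreserving.ae hc] with x h1 h2 h3
    rw [h2, h3, ← Circle.coe_mul, h1]
  · rw [h0] at hc
    obtain ⟨x, h1, h2⟩ := (hc.and (Lp.coeFn_zero ℂ ∞ μ)).exists
    rw [h2] at h1
    exact Circle.coe_ne_zero (w x) h1.symm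

/-- Nonzero bounded solutions normalise to unitary ones, so the levels in `nZero` are the positive
elements of a subgroup. -/
theorem nZero_dvd_iff (hμ : IsUniqueInvariantMeasure θ μ) (f : C(X, Circle)) (n : ℤ) :
    (nZero θ μ f : ℤ) ∣ n ↔ ∃ w, IsUnitarySolution θ μ f n w := by
  have := hμ.isProbabilityMeasure
  refine Iff.trans ?_ (sInf_addSubgroup_dvd_iff (measurableLevels θ μ f) n)
  have : nZero θ μ f = sInf {m : ℕ | 0 < m ∧ (m : ℤ) ∈ measurableLevels θ μ f} := by
    unfold nZero
    congr 1
    ext m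
    refine and_congr_right fun _ => ⟨?_, ?_⟩
    · rintro ⟨g, hg, hne⟩
      rcases ae_eq_zero_or_unitary hμ (Lp.aestronglyMeasurable g) hg with h | ⟨c, _, w, hw, _⟩
      · exact absurd (Lp.eq_zero_iff_ae_eq_zero.2 h) hne
      · exact ⟨w, hw⟩
    · rintro ⟨w, hw⟩
      obtain ⟨g, hg, _, hne⟩ := hw.exists_Lp hμ.measurePreserving
      exact ⟨g, hg, hne⟩
  rw [this]

theorem mZero_dvd_iff (hμ : IsUniqueInvariantMeasure θ μ) (f : C(X, Circle)) (n : ℤ) :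
    (mZero θ f : ℤ) ∣ n ↔ ∃ w : C(X, Circle), ∀ x, w (θ x) * f x ^ n = w x := by
  have := hμ.isProbabilityMeasure
  obtain ⟨x₀⟩ : Nonempty X := μ.nonempty_of_neZero
  refine Iff.trans ?_ (sInf_addSubgroup_dvd_iff (continuousLevels θ f) n)
  have : mZero θ f = sInf {m : ℕ | 0 < m ∧ (m : ℤ) ∈ continuousLevels θ f} := by
    unfold mZero
    congr 1
    ext m
    refine and_congr_right fun _ => ⟨?_, ?_⟩
    · rintro ⟨g, hg, hne⟩
      rcases eq_zero_or_continuous_unitary hμ hg with h | ⟨c, _, w, hw, _⟩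
      · exact absurd h hne
      · exact ⟨w, hw⟩
    · rintro ⟨w, hw⟩
      refine ⟨⟨fun x => w x, by fun_prop⟩, fun x => ?_, fun h0 => ?_⟩
      · simp only [ContinuousMap.coe_mk]
        rw [← Circle.coe_mul, hw]
      · exact Circle.coe_ne_zero (w x₀) (DFunLike.congr_fun h0 x₀)
  rw [this]

theorem nZero_dvd_mZero (hμ : IsUniqueInvariantMeasure θ μ) (f : C(X, Circle)) :
    nZero θ μ f ∣ mZero θ f := by
  obtain ⟨w, hw⟩ := (mZero_dvd_iff hμ f (mZero θ f)).1 dvd_rfl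
  exact_mod_cast (nZero_dvd_iff hμ f (mZero θ f)).2 ⟨w, isUnitarySolution_of_continuous hw⟩

theorem kZero_mul_nZero (hμ : IsUniqueInvariantMeasure θ μ) (f : C(X, Circle)) :
    kZero θ μ f * nZero θ μ f = mZero θ f :=
  Nat.div_mul_cancel (nZero_dvd_mZero hμ f)

theorem nonempty_unitarySolutions (hμ : IsUniqueInvariantMeasure θ μ) (f : C(X, Circle)) :
    Nonempty (UnitarySolutions θ μ f) := by
  obtain ⟨u, hu⟩ := (nZero_dvd_iff hμ f (nZero θ μ f)).1 dvd_rfl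
  obtain ⟨v, hv⟩ := (mZero_dvd_iff hμ f (mZero θ f)).1 dvd_rfl
  have huk := hu.zpow (kZero θ μ f)
  have hkn : (kZero θ μ f : ℤ) * (nZero θ μ f : ℤ) = mZero θ f := by
    exact_mod_cast kZero_mul_nZero hμ f
  rw [hkn] at huk
  -- `u ^ k_o` and `v` solve the equation at the same level `m_o`, so they differ by a constant,
  -- which is absorbed into `v`.
  obtain ⟨c, hc⟩ := huk.ae_eq_const_mul hμ (isUnitarySolution_of_continuous hv)
  refine ⟨{ u := u, measurable_u := hu.measurable, u_eq := ?_, v := ⟨fun x => c * v x, by fun_prop⟩,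
            v_eq := fun x => ?_, v_ae_eq := ?_ }⟩
  · simpa using hu.ae_eq
  · have := hv x
    simp only [zpow_natCast] at this
    simp only [ContinuousMap.coe_mk]
    rw [← this, mul_assoc]
  · filter_upwards [hc] with x hx
    simpa using hx.symm

/-- If there is no measurable solution at the level `n`, the twisted averages tend to zero. -/
theorem tendsto_average_twist_of_no_solution (hμ : IsUniqueInvariantMeasure θ μ) (f : C(X, Circle))
    {n : ℤ} (hn : ¬ ∃ w, IsUnitarySolution θ μ f n w) (g : C(X, ℂ)) :
    Tendsto (fun N => average (twist θ f n) N g) atTop (𝓝 0) := by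
  have := hμ.isProbabilityMeasure
  have := hμ.regular
  by_contra hcon
  obtain ⟨F, hF, x, hx⟩ := exists_ultrafilter_of_not_tendsto hcon
  obtain ⟨φ, hφ⟩ := exists_ultrafilter_limit (averageAt θ f n x) (norm_averageAt_le θ f n x) F
  obtain ⟨φ₀, hφ₀⟩ := exists_ultrafilter_limit (averageAt θ f 0 x) (norm_averageAt_le θ f 0 x) F
  -- Along the same points and ultrafilter, the untwisted averages of `|g|` tend to its integral and
  -- dominate the twisted averages.
  have hb : ∀ g, ‖φ g‖ ≤ ∫ y, ‖g y‖ ∂μ := fun g => by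
    have h1 := le_of_tendsto_of_tendsto' (hφ g).norm (hφ₀ (normMap g)).norm
      fun N => norm_average_twist_apply_le θ f n N g (x N)
    rw [averageAt_limit_eq_integral hμ hF hφ₀] at h1
    simp only [normMap, ContinuousMap.coe_mk] at h1
    rw [integral_complex_ofReal, Complex.norm_real, Real.norm_of_nonneg
      (integral_nonneg fun _ => norm_nonneg _)] at h1
    exact h1
  obtain ⟨H, hH, hφH⟩ := exists_density φ hb
  have hθs : MeasurePreserving θ.symm μ μ :=
    MeasurePreserving.symm θ.toMeasurableEquiv hμ.measurePreserving
  have hmul : MemLp (fun y => H y * character n (f y)) 2 μ := by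
    refine hH.of_le_mul (c := 1) (hH.1.mul (by
      exact (by fun_prop : Continuous fun y => character n (f y)).aestronglyMeasurable)) ?_
    exact Eventually.of_forall fun y => by simp [norm_character]
  have hK := hmul.comp_measurePreserving hθs
  -- After the change of variables by `θ⁻¹`, invariance of `φ` says `(H f ^ n) ∘ θ⁻¹ = H`.
  have hsol : (fun y => (H ∘ θ.symm) y * character n (f (θ.symm y)) - H y) =ᵐ[μ] 0 := by
    refine ae_eq_zero_of_integral_continuous (hK.sub hH) fun g => ?_
    have hint : ∀ K : X → ℂ, MemLp K 2 μ → Integrable (fun y => g y * K y) μ := fun K hK =>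
      (hK.integrable (by norm_num)).bdd_mul g.continuous.aestronglyMeasurable
        (Eventually.of_forall g.norm_coe_le_norm)
    have h1 := averageAt_limit_invariant hF hφ g
    rw [hφH, hφH] at h1
    rw [← hθs.integral_comp θ.symm.measurableEmbedding] at h1
    have h2 : ∀ y, g y * ((H ∘ θ.symm) y * character n (f (θ.symm y)) - H y)
        = twist θ f n g (θ.symm y) * H (θ.symm y) - g y * H y := fun y => by
      simp only [twist_apply, Function.comp_apply, Homeomorph.apply_symm_apply]; ring
    simp only [h2]
    rw [integral_sub _ (hint H hH), h1, sub_self]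
    refine (hint _ hK).congr (Eventually.of_forall fun y => ?_)
    simp only [twist_apply, Function.comp_apply, Homeomorph.apply_symm_apply]; ring
  -- From `H ∘ θ = H f ^ n`, conjugation moves `f ^ n` to the other side: it is `star H` that solves
  -- the equation at level `n`.
  have hsol' : ∀ᵐ y ∂μ, star (H (θ y)) * ((f y ^ n : Circle) : ℂ) = star (H y) := by
    filter_upwards [hμ.measurePreserving.quasiMeasurePreserving.ae hsol] with y hy
    simp only [Function.comp_apply, Homeomorph.symm_apply_apply, Pi.zero_apply, sub_eq_zero] at hy
    rw [← hy, star_mul', mul_assoc]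
    have : star (character n (f y)) * character n (f y) = 1 := by
      simpa [norm_character] using Complex.conj_mul' (character n (f y))
    rw [character_apply] at this
    rw [character_apply, this, mul_one]
  rcases ae_eq_zero_or_unitary hμ hH.star.1 hsol' with h0 | ⟨_, _, w, hw, _⟩
  · refine hx ?_
    have h1 := hφ g
    rwa [hφH, integral_eq_zero_of_ae] at h1
    filter_upwards [h0] with y hy
    have : H y = 0 := by simpa using hy
    simp [this]
  · exact hn ⟨w, hw⟩

end Solutions

/-! ### Measure-preserving maps onto the circle -/

theorem circle_pow_surjective {n : ℕ} (hn : n ≠ 0) : Function.Surjective fun z : Circle => z ^ n := by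
  intro z
  refine ⟨Circle.exp (Complex.arg z / n), ?_⟩
  have : (n : ℝ) ≠ 0 := by exact_mod_cast hn
  change Circle.exp (Complex.arg z / n) ^ n = z
  rw [← Circle.exp_nsmul, nsmul_eq_mul, mul_div_cancel₀ _ this, Circle.exp_arg]

theorem measurePreserving_circle_pow {n : ℕ} (hn : n ≠ 0) :
    MeasurePreserving (fun z : Circle => z ^ n) haarCircle haarCircle :=
  MonoidHom.measurePreserving (f := (powMonoidHom n : Circle →* Circle)) (continuous_pow n)
    (circle_pow_surjective hn) rfl

theorem measurePreserving_circle_mul_pow {n : ℕ} (hn : n ≠ 0) (c : Circle) :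
    MeasurePreserving (fun z : Circle => c * z ^ n) haarCircle haarCircle :=
  (measurePreserving_mul_left haarCircle c).comp (measurePreserving_circle_pow hn)

/-- On each fibre `z ↦ u x * z ^ n` preserves Haar measure whatever `u x` is, so measurability of
`u` suffices. -/
theorem measurePreserving_mul_pow {X : Type*} [MeasurableSpace X] {μ : Measure X}
    [IsProbabilityMeasure μ] {u : X → Circle} (hu : Measurable u) {n : ℕ} (hn : n ≠ 0) :
    MeasurePreserving (fun p : X × Circle => u p.1 * p.2 ^ n) (μ.prod haarCircle) haarCircle :=
  measurePreserving_snd.comp ((MeasurePreserving.id μ).skew_product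
    (g := fun x z => u x * z ^ n)
    ((hu.comp measurable_fst).mul (measurable_snd.pow_const _))
    (ae_of_all _ fun x => (measurePreserving_circle_mul_pow hn (u x)).map_eq))

/-! ### Fejér sums along a measure-preserving map onto the circle -/

section Fejer

variable {Y : Type*} [TopologicalSpace Y] [CompactSpace Y] [MeasurableSpace Y] [BorelSpace Y]
  {ν : Measure Y} [IsProbabilityMeasure ν] {w : Y → Circle}

theorem integrable_comp_circle (q : C(Circle, ℂ)) (hw : Measurable w) :
    Integrable (fun y => q (w y)) ν :=
  memLp_one_iff_integrable.1 ((memLp_comp ν q hw).mono_exponent le_top)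

/-- The functional `q ↦ ∫ q(w) ψ`. -/
def integralCompCLM (ν : Measure Y) [IsProbabilityMeasure ν] {w : Y → Circle} (hw : Measurable w)
    {ψ : Y → ℂ} (hψ : Integrable ψ ν) : C(Circle, ℂ) →L[ℂ] ℂ :=
  LinearMap.mkContinuous
    { toFun := fun q => ∫ y, q (w y) * ψ y ∂ν
      map_add' := fun p q => by
        simp only [ContinuousMap.add_apply, add_mul]
        refine integral_add ?_ ?_ <;>
        exact hψ.bdd_mul (memLp_comp ν _ hw).1
          (Eventually.of_forall fun y => ContinuousMap.norm_coe_le_norm _ (w y))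
      map_smul' := fun c q => by
        simp only [ContinuousMap.smul_apply, smul_eq_mul, mul_assoc, RingHom.id_apply]
        exact integral_const_mul _ _ }
    (∫ y, ‖ψ y‖ ∂ν) (fun q => by
      rw [mul_comm, ← integral_const_mul]
      refine norm_integral_le_of_norm_le (hψ.norm.const_mul _) (Eventually.of_forall fun y => ?_)
      simp only [norm_mul]
      gcongr
      exact q.norm_coe_le_norm (w y))

theorem integralCompCLM_apply (hw : Measurable w) {ψ : Y → ℂ} (hψ : Integrable ψ ν)
    (q : C(Circle, ℂ)) : integralCompCLM ν hw hψ q = ∫ y, q (w y) * ψ y ∂ν := rfl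

/-- The `l`-th Fourier coefficient of `h` along `w`. -/
def coefficient (ν : Measure Y) [IsProbabilityMeasure ν] {w : Y → Circle} (hw : Measurable w)
    (l : ℤ) : C(Y, ℂ) →L[ℂ] ℂ :=
  integralMulCLM ν (fun y => character (-l) (w y)) (integrable_comp_circle _ hw)

theorem coefficient_apply (hw : Measurable w) (l : ℤ) (h : C(Y, ℂ)) :
    coefficient ν hw l h = ∫ y, h y * character (-l) (w y) ∂ν := rfl

/-- The symmetric partial sums of the Fourier series along `w`. -/
def partialSum (ν : Measure Y) [IsProbabilityMeasure ν] {w : Y → Circle} (hw : Measurable w)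
    (j : ℕ) : C(Y, ℂ) →ₗ[ℂ] C(Circle, ℂ) :=
  ∑ l ∈ Finset.Icc (-(j : ℤ)) (j : ℤ), (coefficient ν hw l).toLinearMap.smulRight (character l)

theorem partialSum_apply (hw : Measurable w) (j : ℕ) (h : C(Y, ℂ)) :
    partialSum ν hw j h
      = ∑ l ∈ Finset.Icc (-(j : ℤ)) (j : ℤ), coefficient ν hw l h • character l := by
  simp [partialSum, LinearMap.sum_apply]

/-- The arithmetic means of the partial sums. -/
def fejerSum (ν : Measure Y) [IsProbabilityMeasure ν] {w : Y → Circle} (hw : Measurable w)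
    (N : ℕ) : C(Y, ℂ) →ₗ[ℂ] C(Circle, ℂ) :=
  (N : ℂ)⁻¹ • ∑ j ∈ Finset.range N, partialSum ν hw j

theorem fejerSum_apply (hw : Measurable w) (N : ℕ) (h : C(Y, ℂ)) :
    fejerSum ν hw N h = (N : ℂ)⁻¹ • ∑ j ∈ Finset.range N, partialSum ν hw j h := by
  simp [fejerSum, LinearMap.sum_apply]

theorem tendsto_fejer_of_tendsto {W : Type*} [NormedAddCommGroup W] [NormedSpace ℂ W]
    {s : ℕ → W} {c : W} (h : Tendsto s atTop (𝓝 c)) :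
    Tendsto (fun N : ℕ => (N : ℂ)⁻¹ • ∑ j ∈ Finset.range N, s j) atTop (𝓝 c) := by
  have := h.cesaro_smul
  refine this.congr fun N => ?_
  rw [← Complex.coe_smul]
  push_cast; rfl

/-- The sum at `ζ` is `1/N` times the integral of `h` against `K ∘ w`, where the Fejér kernel `K` is
nonnegative with Haar integral `N`. Since `w` preserves measure, `K ∘ w` has the same mass. -/
theorem norm_fejerSum_le (hw : MeasurePreserving w ν haarCircle) (N : ℕ) (h : C(Y, ℂ)) :
    ‖fejerSum ν hw.measurable N h‖ ≤ ‖h‖ := by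
  rcases Nat.eq_zero_or_pos N with rfl | hN
  · simp [fejerSum_apply]
  rw [ContinuousMap.norm_le _ (norm_nonneg _)]
  intro ζ
  let K : C(Circle, ℂ) := ∑ j ∈ Finset.range N, ∑ l ∈ Finset.Icc (-(j : ℤ)) (j : ℤ),
    character l ζ • character (-l)
  have hK : ∀ s, K s = ((‖∑ j ∈ Finset.range N, character j (ζ * s⁻¹)‖ ^ 2 : ℝ) : ℂ) := fun s => by
    rw [← fejer_sum]
    simp [K, character_apply, mul_zpow]
  have hKint : ∫ s, K s ∂haarCircle = N := by
    have h1 := integralMulCLM_apply haarCircle 1 (integrable_const (1 : ℂ)) K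
    simp only [Pi.one_apply, mul_one] at h1
    rw [← h1]
    simp only [K, map_sum, map_smul, integralMulCLM_apply, Pi.one_apply, mul_one,
      integral_character, neg_eq_zero, smul_eq_mul, mul_ite, mul_zero]
    simp [character_zero]
  have hval : fejerSum ν hw.measurable N h ζ = (N : ℂ)⁻¹ * ∫ y, h y * K (w y) ∂ν := by
    have h2 : ∀ y, h y * K (w y) = ∑ j ∈ Finset.range N, ∑ l ∈ Finset.Icc (-(j : ℤ)) (j : ℤ),
        (h y * character (-l) (w y)) * character l ζ := fun y => by
      simp only [K, ContinuousMap.sum_apply, ContinuousMap.smul_apply, smul_eq_mul,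
        Finset.mul_sum]
      refine Finset.sum_congr rfl fun j _ => Finset.sum_congr rfl fun l _ => by ring
    have hi : ∀ l, Integrable (fun y => (h y * character (-l) (w y)) * character l ζ) ν := fun l =>
      ((integrable_comp_circle _ hw.measurable).bdd_mul h.continuous.aestronglyMeasurable
        (Eventually.of_forall h.norm_coe_le_norm)).mul_const _
    simp only [h2]
    rw [integral_finsetSum _ fun j _ => integrable_finsetSum _ fun l _ => hi l]
    simp only [integral_finsetSum _ fun l _ => hi l, integral_mul_const]
    simp [fejerSum_apply, partialSum_apply, coefficient_apply]
  have hKw : ∫ y, ‖K (w y)‖ ∂ν = N := by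
    have h1 : ∫ y, ‖K (w y)‖ ∂ν = ∫ s, ‖K s‖ ∂haarCircle := by
      rw [← hw.map_eq]
      exact (integral_map hw.measurable.aemeasurable
        (K.continuous.norm.aestronglyMeasurable)).symm
    rw [h1]
    have h2 : ∀ s, K s = ((‖K s‖ : ℝ) : ℂ) := fun s => by
      rw [hK, Complex.norm_real, Real.norm_of_nonneg (by positivity)]
    have h3 : ((∫ s, ‖K s‖ ∂haarCircle : ℝ) : ℂ) = N := by
      rw [← integral_complex_ofReal, ← hKint]
      exact integral_congr_ae (Eventually.of_forall fun s => (h2 s).symm)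
    exact_mod_cast h3
  have hN' : (0 : ℝ) < N := by exact_mod_cast hN
  rw [hval, norm_mul, norm_inv, Complex.norm_natCast, inv_mul_le_iff₀ hN', mul_comm, ← hKw,
    ← integral_const_mul]
  refine norm_integral_le_of_norm_le ((integrable_comp_circle K hw.measurable).norm.const_mul _)
    (Eventually.of_forall fun y => ?_)
  rw [norm_mul]
  gcongr
  exact h.norm_coe_le_norm y

/-- If the Fejér sums converge, the limit is the conditional expectation along `w`. -/
theorem integral_limit_mul (hw : Measurable w) {h : C(Y, ℂ)} {Q : C(Circle, ℂ)}
    (hQ : Tendsto (fun N => fejerSum ν hw N h) atTop (𝓝 Q)) (q : C(Circle, ℂ)) :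
    ∫ z, Q z * q z ∂haarCircle = ∫ y, h y * q (w y) ∂ν := by
  have key : integralMulCLM haarCircle Q (integrable_haarCircle Q)
      = integralCompCLM ν hw (integrable_continuousMap ν h) := clm_circle_ext fun k => by
    let I := integralMulCLM haarCircle (character k) (integrable_haarCircle _)
    have h1 : I Q = coefficient ν hw (-k) h := by
      refine tendsto_nhds_unique ((I.continuous.tendsto _).comp hQ) ?_
      -- A fixed Fourier coefficient of the partial sums is constant from `j = |k|` on, so it
      -- survives the Cesàro means.
      have h2 : ∀ j : ℕ, k.natAbs ≤ j → I (partialSum ν hw j h) = coefficient ν hw (-k) h := by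
        intro j hj
        simp only [partialSum_apply, map_sum, map_smul, I, integralMulCLM_apply]
        have : ∀ l, ∫ z, character l z * character k z ∂haarCircle = if l = -k then 1 else 0 := by
          intro l
          simp only [← ContinuousMap.mul_apply, ← character_add, integral_character,
            eq_neg_iff_add_eq_zero]
        simp only [this, smul_eq_mul, mul_ite, mul_one, mul_zero, Finset.sum_ite_eq']
        rw [if_pos]
        simp only [Finset.mem_Icc]
        omega
      have h3 : Tendsto (fun j => I (partialSum ν hw j h)) atTop (𝓝 (coefficient ν hw (-k) h)) :=
        tendsto_const_nhds.congr' (by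
          filter_upwards [eventually_ge_atTop k.natAbs] with j hj using (h2 j hj).symm)
      refine (tendsto_fejer_of_tendsto h3).congr fun N => ?_
      simp [fejerSum_apply]
    rw [integralMulCLM_apply, integralCompCLM_apply]
    simp only [mul_comm (character k _)]
    rw [coefficient_apply, neg_neg] at h1
    exact h1
  have := DFunLike.congr_fun key q
  rw [integralMulCLM_apply, integralCompCLM_apply] at this
  simpa only [mul_comm] using this

end Fejer

/-! ### Norm convergence of Fejér sums on `X × 𝕋` -/

section FejerProd

variable {X : Type*} [TopologicalSpace X] [CompactSpace X] [T2Space X]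
  [MeasurableSpace X] [BorelSpace X] {μ : Measure X} [IsProbabilityMeasure μ]

theorem integral_tensor_mul (u : X → Circle) (n : ℕ) (g : C(X, ℂ)) (k l : ℤ) :
    ∫ p, tensor g k p * character l (u p.1 * p.2 ^ n) ∂(μ.prod haarCircle)
      = if k + l * n = 0 then ∫ x, g x * character l (u x) ∂μ else 0 := by
  have h1 : ∀ p : X × Circle, tensor g k p * character l (u p.1 * p.2 ^ n)
      = (g p.1 * character l (u p.1)) * character (k + l * n) p.2 := fun p => by
    rw [tensor_apply, character_add]
    simp only [character_apply, ContinuousMap.mul_apply, mul_zpow, Circle.coe_mul,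
      mul_comm l, zpow_mul, zpow_natCast]
    ring
  simp only [h1]
  rw [integral_prod_mul (fun x => g x * character l (u x)) fun z => character (k + l * n) z,
    integral_character]
  simp

/-- By contractivity only tensors `g ⊗ χ_k` matter. At most one of their coefficients is nonzero,
the one with `k = l n`, so their partial sums are eventually constant. -/
theorem exists_tendsto_fejerSum {u : X → Circle} (hu : Measurable u) {n : ℕ} (hn : n ≠ 0)
    (h : C(X × Circle, ℂ)) :
    ∃ Q, Tendsto (fun N => fejerSum (μ.prod haarCircle)
      (measurePreserving_mul_pow (μ := μ) hu hn).measurable N h) atTop (𝓝 Q) := by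
  set hw := measurePreserving_mul_pow (μ := μ) hu hn
  have := submodule_prod_circle_eq_top
    (convergenceSubmodule (fejerSum (μ.prod haarCircle) hw.measurable))
    (isClosed_convergenceSubmodule _ (norm_fejerSum_le hw)) fun g k => by
      have hc : ∀ l, coefficient (μ.prod haarCircle) hw.measurable l (tensor g k)
          = if k = l * n then ∫ x, g x * character (-l) (u x) ∂μ else 0 := fun l => by
        rw [coefficient_apply, integral_tensor_mul]
        congr 1
        simp only [eq_iff_iff]
        constructor <;> intro h <;> linarith
      suffices ∃ q, Tendsto (fun j => partialSum (μ.prod haarCircle) hw.measurable j (tensor g k))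
          atTop (𝓝 q) by
        obtain ⟨q, hq⟩ := this
        exact ⟨q, (tendsto_fejer_of_tendsto hq).congr fun N => (fejerSum_apply _ _ _).symm⟩
      by_cases hk : ∃ l : ℤ, k = l * n
      · obtain ⟨l, rfl⟩ := hk
        refine ⟨(∫ x, g x * character (-l) (u x) ∂μ) • character l, tendsto_const_nhds.congr' ?_⟩
        filter_upwards [eventually_ge_atTop l.natAbs] with j hj
        have : ∀ l' : ℤ, l * n = l' * n ↔ l = l' := fun l' => by
          constructor
          · intro h; exact mul_right_cancel₀ (by exact_mod_cast hn) h
          · rintro rfl; rfl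
        simp only [partialSum_apply, hc, this, ite_smul, zero_smul, Finset.sum_ite_eq]
        rw [if_pos]
        simp only [Finset.mem_Icc]
        omega
      · refine ⟨0, tendsto_const_nhds.congr fun j => ?_⟩
        rw [partialSum_apply]
        refine (Finset.sum_eq_zero fun l _ => ?_).symm
        rw [hc, if_neg fun h => hk ⟨l, h⟩, zero_smul]
  have hh : h ∈ convergenceSubmodule (fejerSum (μ.prod haarCircle) hw.measurable) :=
    this ▸ Submodule.mem_top
  exact hh

end FejerProd

namespace UnitarySolutions

variable {X : Type*} [TopologicalSpace X] [CompactSpace X] [T2Space X]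
  [MeasurableSpace X] [BorelSpace X] {θ : X ≃ₜ X} {μ : Measure X} {f : C(X, Circle)}

theorem measurePreserving_base [IsProbabilityMeasure μ] (D : UnitarySolutions θ μ f)
    (hn : nZero θ μ f ≠ 0) : MeasurePreserving D.base (μ.prod haarCircle) haarCircle :=
  measurePreserving_mul_pow D.measurable_u hn

/-- The map `ρ_1⁻¹` as a continuous linear map. -/
def rhoInvCLM [IsProbabilityMeasure μ] (D : UnitarySolutions θ μ f) :
    C(Circle, ℂ) →L[ℂ] Lp ℂ ∞ (μ.prod haarCircle) :=
  LinearMap.mkContinuous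
    { toFun := D.rhoInv
      map_add' := fun _ _ => rfl
      map_smul' := fun _ _ => rfl } 1 (fun q => by
        have h := Lp.norm_le_of_ae_bound (f := D.rhoInv q) (norm_nonneg q) (by
          filter_upwards [(memLp_comp (μ.prod haarCircle) q D.measurable_base).coeFn_toLp] with p hp
          rw [rhoInv, hp]
          exact q.norm_coe_le_norm _)
        simp only [ENNReal.toReal_top, inv_zero, Real.rpow_zero, one_mul] at h
        rw [one_mul]
        exact h)

/-- `D.base` pushes the product measure to Haar measure, which has full support. Hence the
`Function.invFun` in `rho` is a true left inverse. -/
theorem rhoInv_injective [IsProbabilityMeasure μ] (D : UnitarySolutions θ μ f)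
    (hn : nZero θ μ f ≠ 0) : Function.Injective D.rhoInv := by
  intro q r hqr
  have h1 := (MemLp.toLp_eq_toLp_iff _ _).1 hqr
  have h2 : q =ᵐ[haarCircle] r := by
    have h3 := D.measurePreserving_base hn
    rw [← h3.map_eq]
    exact (ae_map_iff h3.measurable.aemeasurable
      (measurableSet_eq_fun q.continuous.measurable r.continuous.measurable)).2 h1
  exact DFunLike.coe_injective ((Continuous.ae_eq_iff_eq haarCircle q.continuous r.continuous).1 h2)

theorem integral_fourierCoeff [IsProbabilityMeasure μ] (D : UnitarySolutions θ μ f)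
    (h : C(X × Circle, ℂ)) (l : ℤ) :
    ∫ x, fourierCoeff h (l * nZero θ μ f) x * ((D.u x ^ (-l) : Circle) : ℂ) ∂μ
      = coefficient (μ.prod haarCircle) D.measurable_base l h := by
  rw [coefficient_apply, integral_prod]
  · refine integral_congr_ae (Eventually.of_forall fun x => ?_)
    simp only [fourierCoeff]
    rw [← integral_mul_const]
    refine integral_congr_ae (Eventually.of_forall fun z => ?_)
    simp only [character_apply, base, mul_zpow, Circle.coe_mul]
    rw [← zpow_natCast, ← zpow_mul, mul_neg, mul_comm (nZero θ μ f : ℤ)]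
    ring
  · exact (integrable_comp_circle _ D.measurable_base).bdd_mul h.continuous.aestronglyMeasurable
        (Eventually.of_forall h.norm_coe_le_norm)

/-- The function `ρ_1(T(h))` is the conditional expectation of `h` along `u(x) z ^ n_o`. -/
theorem integral_rho_T_mul [IsProbabilityMeasure μ] (D : UnitarySolutions θ μ f)
    (hn : nZero θ μ f ≠ 0) (h : C(X × Circle, ℂ)) (q : C(Circle, ℂ)) :
    ∫ z, D.rho (D.T h) z * q z ∂haarCircle = ∫ p, h p * q (D.base p) ∂(μ.prod haarCircle) := by
  obtain ⟨Q, hQ⟩ := exists_tendsto_fejerSum (μ := μ) D.measurable_u hn h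
  -- The means defining `T` are images under `rhoInv` of Fejér sums in `C(𝕋)`, so continuity
  -- identifies the limit.
  have hT : D.T h = D.rhoInv Q := by
    refine Tendsto.limUnder_eq ?_
    refine ((D.rhoInvCLM.continuous.tendsto _).comp hQ).congr fun N => ?_
    simp only [Function.comp_apply, fejerSum_apply, partialSum_apply, map_smul, map_sum,
      D.integral_fourierCoeff]
    rfl
  rw [hT, rho, Function.leftInverse_invFun (D.rhoInv_injective hn)]
  exact integral_limit_mul _ hQ q

end UnitarySolutions

/-! ### Roots of unity -/

/-- A primitive `k`-th root of unity in the circle. -/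
def circleRoot (k : ℕ) : Circle := Circle.exp (2 * Real.pi / k)

theorem circleRoot_zpow_eq_one_iff {k : ℕ} (hk : k ≠ 0) (m : ℤ) :
    circleRoot k ^ m = 1 ↔ (k : ℤ) ∣ m := by
  have hk' : (k : ℝ) ≠ 0 := by exact_mod_cast hk
  rw [circleRoot, ← Circle.exp_zsmul, Circle.exp_eq_one]
  refine exists_congr fun n => ?_
  rw [zsmul_eq_mul]
  constructor
  · intro h
    field_simp at h
    have : (m : ℝ) = k * n := by linarith
    exact_mod_cast this
  · rintro rfl
    push_cast
    field_simp

theorem circleRoot_pow_pow {k : ℕ} (hk : k ≠ 0) (t : ℕ) : (circleRoot k ^ t) ^ k = 1 := by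
  rw [← pow_mul, ← zpow_natCast, circleRoot_zpow_eq_one_iff hk]
  simp

theorem sum_character_circleRoot {k : ℕ} (hk : k ≠ 0) (m : ℤ) :
    ∑ t ∈ Finset.range k, character m (circleRoot k ^ t) = if (k : ℤ) ∣ m then (k : ℂ) else 0 := by
  have h1 : ∀ t : ℕ, character m (circleRoot k ^ t) = ((circleRoot k ^ m : Circle) : ℂ) ^ t :=
    fun t => by
      rw [character_apply, ← Circle.coe_pow, ← zpow_natCast, ← zpow_natCast, zpow_comm]
  simp only [h1]
  split_ifs with h
  · rw [(circleRoot_zpow_eq_one_iff hk m).2 h]; simp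
  · have hne : ((circleRoot k ^ m : Circle) : ℂ) ≠ 1 := by
      rw [Ne, Circle.coe_eq_one, circleRoot_zpow_eq_one_iff hk]; exact h
    rw [geom_sum_eq hne, ← Circle.coe_pow, ← zpow_natCast, ← zpow_mul,
      (circleRoot_zpow_eq_one_iff hk _).2 (Dvd.intro_left m rfl)]
    simp

/-! ### The shift unitary and its functional calculus -/

section Shift

variable {k : ℕ}

/-- The cyclic successor on `Fin k`. -/
def cyclicSucc (j : Fin k) : Fin k :=
  if h : (j : ℕ) + 1 = k then ⟨0, by omega⟩ else ⟨j + 1, by omega⟩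

theorem cyclicSucc_injective : Function.Injective (cyclicSucc (k := k)) := by
  intro i j h
  unfold cyclicSucc at h
  split_ifs at h <;> simp [Fin.ext_iff] at h ⊢ <;> omega

theorem shiftUnitary_apply (i j : Fin k) :
    shiftUnitary k i j = if i = cyclicSucc j then (if (j : ℕ) + 1 = k then character 1 else 1)
      else 0 := by
  change (if (i : ℕ) = (j : ℕ) + 1 then (1 : C(Circle, ℂ))
    else if (i : ℕ) = 0 ∧ (j : ℕ) + 1 = k then character 1 else 0) = _
  unfold cyclicSucc
  have := i.2
  by_cases h : (j : ℕ) + 1 = k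
  · simp only [h, dif_pos, if_true, Fin.ext_iff, and_true]
    rw [if_neg (by omega)]
  · simp only [h, if_false, Fin.ext_iff, and_false, dif_neg, not_false_eq_true]

theorem star_shiftUnitary_mul : star (shiftUnitary k) * shiftUnitary k = 1 := by
  refine CStarMatrix.ext fun i j => ?_
  rw [CStarMatrix.mul_apply]
  simp only [CStarMatrix.star_apply, shiftUnitary_apply, mul_ite, mul_zero, Finset.sum_ite_eq',
    Finset.mem_univ, if_true]
  rw [CStarMatrix.one_apply]
  by_cases h : i = j
  · subst h
    simp only [if_true]
    split_ifs
    · rw [star_character, ← character_add, neg_add_cancel, character_zero]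
    · simp
  · rw [if_neg h, if_neg fun hs => h (cyclicSucc_injective hs).symm]
    simp

/-- Over a commutative ring a one-sided inverse of a square matrix is two-sided. -/
theorem shiftUnitary_mul_star : shiftUnitary k * star (shiftUnitary k) = 1 :=
  (mul_eq_one_comm (M := Matrix (Fin k) (Fin k) C(Circle, ℂ))).1 star_shiftUnitary_mul

theorem shiftUnitary_mem_unitary (k : ℕ) : shiftUnitary k ∈ unitary _ :=
  Unitary.mem_iff.2 ⟨star_shiftUnitary_mul, shiftUnitary_mul_star⟩

theorem isStarNormal_shiftUnitary (k : ℕ) : IsStarNormal (shiftUnitary k) :=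
  ⟨by rw [commute_iff_eq, star_shiftUnitary_mul, shiftUnitary_mul_star]⟩

/-- The inclusion of the spectrum of the shift unitary into the circle. -/
def shiftSpectrumEmb (k : ℕ) : C(spectrum ℂ (shiftUnitary k), Circle) where
  toFun s := ⟨s, by
    have := spectrum.subset_circle_of_unitary (shiftUnitary_mem_unitary k) s.2
    simpa [Submonoid.unitSphere] using this⟩
  continuous_toFun := by fun_prop

/-- The map `π_k` as a `*`-homomorphism. -/
def piStarHom (k : ℕ) : C(Circle, ℂ) →⋆ₐ[ℂ] CStarMatrix (Fin k) (Fin k) C(Circle, ℂ) :=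
  (cfcHom (isStarNormal_shiftUnitary k)).comp ((shiftSpectrumEmb k).compStarAlgHom' ℂ ℂ)

/-- The spectrum lies on the circle, so the extension by zero is continuous there and `cfc` does not
fall back to its default value. -/
theorem piHom_eq (k : ℕ) (q : C(Circle, ℂ)) : piHom k q = piStarHom k q := by
  have hext : ∀ s : spectrum ℂ (shiftUnitary k),
      Function.extend ((↑) : Circle → ℂ) q 0 (s : ℂ) = q (shiftSpectrumEmb k s) := fun s =>
    Subtype.val_injective.extend_apply (⇑q) 0 (shiftSpectrumEmb k s)
  have hc : ContinuousOn (Function.extend ((↑) : Circle → ℂ) q 0)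
      (spectrum ℂ (shiftUnitary k)) := by
    rw [continuousOn_iff_continuous_domRestrict]
    refine (q.comp (shiftSpectrumEmb k)).continuous.congr fun s => ?_
    rw [Set.domRestrict_apply, hext]; rfl
  rw [piHom, cfc_apply _ _ (isStarNormal_shiftUnitary k) hc]
  change _ = cfcHom _ _
  congr 1
  ext s
  exact hext s

theorem continuous_piStarHom (k : ℕ) : Continuous (piStarHom k) :=
  (cfcHom_continuous (isStarNormal_shiftUnitary k)).comp (ContinuousMap.continuous_precomp _)

theorem piStarHom_character_one (k : ℕ) : piStarHom k (character 1) = shiftUnitary k := by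
  have := cfcHom_id (R := ℂ) (isStarNormal_shiftUnitary k)
  conv_rhs => rw [← this]
  change cfcHom _ _ = cfcHom _ _
  congr 1
  ext s
  simp [character_apply, shiftSpectrumEmb]
  rfl

/-- The product of the row `(1, z, …, z^{k-1})` with the value of `M` at `z^k`. -/
def rowEval (z : Circle) (j : Fin k) :
    CStarMatrix (Fin k) (Fin k) C(Circle, ℂ) →ₗ[ℂ] ℂ where
  toFun M := ∑ i : Fin k, character (i : ℕ) z * M i j (z ^ k)
  map_add' M N := by
    simp only [CStarMatrix.add_apply, ContinuousMap.add_apply, mul_add, Finset.sum_add_distrib]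
  map_smul' c M := by
    simp only [CStarMatrix.smul_apply, ContinuousMap.smul_apply, smul_eq_mul, RingHom.id_apply,
      Finset.mul_sum]
    exact Finset.sum_congr rfl fun i _ => by ring

theorem rowEval_apply (z : Circle) (j : Fin k) (M : CStarMatrix (Fin k) (Fin k) C(Circle, ℂ)) :
    rowEval z j M = ∑ i : Fin k, character (i : ℕ) z * M i j (z ^ k) := rfl

theorem continuous_rowEval (z : Circle) (j : Fin k) : Continuous (rowEval z j) := by
  change Continuous fun M : CStarMatrix (Fin k) (Fin k) C(Circle, ℂ) =>
    ∑ i : Fin k, character (i : ℕ) z * M i j (z ^ k)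
  refine continuous_finsetSum _ fun i _ => continuous_const.mul ?_
  have h : Continuous fun M : CStarMatrix (Fin k) (Fin k) C(Circle, ℂ) => M i j := by
    refine LipschitzWith.continuous (K := 1) (LipschitzWith.of_dist_le_mul fun M N => ?_)
    rw [dist_eq_norm, dist_eq_norm, NNReal.coe_one, one_mul, ← CStarMatrix.sub_apply]
    exact CStarMatrix.norm_entry_le_norm
  exact (ContinuousMap.evalCLM ℂ (z ^ k)).continuous.comp h

/-- The hypothesis says that `(1, z, …, z ^ (k - 1))` is a left eigenvector of `M` at `z ^ k` with
eigenvalue `c`. -/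
theorem rowEval_mul {z : Circle} {M : CStarMatrix (Fin k) (Fin k) C(Circle, ℂ)} {c : ℂ}
    (hM : ∀ j, rowEval z j M = c * character (j : ℕ) z)
    (N : CStarMatrix (Fin k) (Fin k) C(Circle, ℂ)) (j : Fin k) :
    rowEval z j (M * N) = c * rowEval z j N := by
  simp only [rowEval_apply, CStarMatrix.mul_apply, ContinuousMap.sum_apply,
    ContinuousMap.mul_apply, Finset.mul_sum] at hM ⊢
  rw [Finset.sum_comm]
  refine Finset.sum_congr rfl fun i _ => ?_
  rw [← mul_assoc, ← hM i, Finset.sum_mul]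
  exact Finset.sum_congr rfl fun l _ => by ring

theorem rowEval_one (z : Circle) (j : Fin k) :
    rowEval z j (1 : CStarMatrix (Fin k) (Fin k) C(Circle, ℂ)) = character (j : ℕ) z := by
  rw [rowEval_apply]
  rw [Finset.sum_eq_single j]
  · simp
  · intro i _ h
    simp [h]
  · simp

/-- The corner entry has value `z ^ k` at `z ^ k`, which matches the wrap-around from `z ^ (k - 1)`
to `1`. -/
theorem rowEval_shiftUnitary (z : Circle) (j : Fin k) :
    rowEval z j (shiftUnitary k) = (z : ℂ) * character (j : ℕ) z := by
  rw [rowEval_apply, Finset.sum_eq_single (cyclicSucc j)]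
  · rw [shiftUnitary_apply, if_pos rfl, cyclicSucc]
    split_ifs with h
    · simp [character_apply, ← h, pow_succ']
    · simp [character_apply, zpow_add_one₀ (Circle.coe_ne_zero z), mul_comm]
  · intro i _ h
    rw [shiftUnitary_apply, if_neg h]; simp
  · simp

theorem rowEval_character (z : Circle) (n : ℤ) (j : Fin k) :
    rowEval z j (piStarHom k (character n)) = character n z * character (j : ℕ) z := by
  have h1 : ∀ j : Fin k, rowEval z j (piStarHom k (character 1))
      = (z : ℂ) * character (j : ℕ) z := fun j => by
    rw [piStarHom_character_one, rowEval_shiftUnitary]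
  have h2 : ∀ j : Fin k, rowEval z j (piStarHom k (character (-1)))
      = (z : ℂ)⁻¹ * character (j : ℕ) z := fun j => by
    have h := rowEval_mul h1 (piStarHom k (character (-1))) j
    rw [← map_mul, ← character_add, add_neg_cancel, character_zero, map_one, rowEval_one] at h
    rw [h, inv_mul_cancel_left₀ (Circle.coe_ne_zero z)]
  induction n using Int.induction_on generalizing j with
  | zero => simp [character_zero, rowEval_one]
  | succ n ih =>
    rw [add_comm, character_add, map_mul, rowEval_mul h1, ih]
    simp [character_apply, mul_assoc]
  | pred n ih =>
    rw [sub_eq_add_neg, add_comm, character_add, map_mul, rowEval_mul h2, ih]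
    simp [character_apply, mul_assoc]

/-- The eigenvector relation extends from characters by density. At `j = 0` it recovers `q` from
`π_k(q)`. -/
theorem rowEval_piStarHom (z : Circle) (q : C(Circle, ℂ)) (j : Fin k) :
    rowEval z j (piStarHom k q) = q z * character (j : ℕ) z := by
  let F : C(Circle, ℂ) →L[ℂ] ℂ :=
    ⟨rowEval z j ∘ₗ (piStarHom k).toAlgHom.toLinearMap,
      (continuous_rowEval z j).comp (continuous_piStarHom k)⟩
  let G : C(Circle, ℂ) →L[ℂ] ℂ := character (j : ℕ) z • ContinuousMap.evalCLM ℂ z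
  have : F = G := clm_circle_ext fun n => by
    change rowEval z j (piStarHom k (character n)) = character (j : ℕ) z * character n z
    rw [rowEval_character, mul_comm]
  have h : F q = G q := by rw [this]
  change rowEval z j (piStarHom k q) = character (j : ℕ) z * q z at h
  rw [h, mul_comm]

theorem piStarHom_injective (hk : k ≠ 0) : Function.Injective (piStarHom k) := by
  intro q r h
  ext z
  have h1 := rowEval_piStarHom z q ⟨0, Nat.pos_of_ne_zero hk⟩
  rw [h, rowEval_piStarHom] at h1
  simpa [character_apply] using h1.symm

/-- With `ω` a primitive `k`-th root of unity, the points `ω ^ t z` share their `k`-th power, so the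
eigenvector relation gives `k` equations for one column. Orthogonality of roots of unity solves
them. -/
theorem piStarHom_entry (hk : k ≠ 0) (q : C(Circle, ℂ)) (z : Circle) (i j : Fin k) :
    (k : ℂ) * piStarHom k q i j (z ^ k)
      = ∑ t ∈ Finset.range k, q (circleRoot k ^ t * z)
          * character ((j : ℤ) - (i : ℤ)) (circleRoot k ^ t * z) := by
  have h1 : ∀ t : ℕ, ∑ a : Fin k, character (a : ℕ) (circleRoot k ^ t * z)
      * piStarHom k q a j (z ^ k)
      = q (circleRoot k ^ t * z) * character (j : ℕ) (circleRoot k ^ t * z) := fun t => by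
    rw [← rowEval_piStarHom, rowEval_apply, mul_pow, circleRoot_pow_pow hk, one_mul]
  have h2 : ∀ t : ℕ, q (circleRoot k ^ t * z)
        * character ((j : ℤ) - (i : ℤ)) (circleRoot k ^ t * z)
      = ∑ a : Fin k, character ((a : ℤ) - i) (circleRoot k ^ t)
          * (character ((a : ℤ) - i) z * piStarHom k q a j (z ^ k)) := fun t => by
    rw [sub_eq_add_neg, character_add, ContinuousMap.mul_apply, ← mul_assoc, ← h1 t,
      Finset.sum_mul]
    refine Finset.sum_congr rfl fun a _ => ?_
    rw [sub_eq_add_neg, character_add]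
    simp only [ContinuousMap.mul_apply, character_apply, mul_zpow, Circle.coe_mul]
    ring
  simp only [h2]
  rw [Finset.sum_comm]
  simp only [← Finset.sum_mul, sum_character_circleRoot hk]
  rw [Finset.sum_eq_single i]
  · simp [character_zero]
  · intro a _ ha
    rw [if_neg, zero_mul]
    intro hd
    refine ha (Fin.ext ?_)
    have h3 := Int.eq_zero_of_abs_lt_dvd hd (by rw [abs_lt]; omega)
    omega
  · simp

theorem powEmb_injective (hk : k ≠ 0) : Function.Injective (powEmb k) := by
  intro q r h
  ext w
  obtain ⟨z, rfl⟩ := circle_pow_surjective hk w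
  exact DFunLike.congr_fun h z

/-- A function of `z ^ k` is constant on the points `ω ^ t z`, so the entry formula kills the
off-diagonal part. Hence `traceExp` lands in the range of `piHom`. -/
theorem piStarHom_powEmb (hk : k ≠ 0) (d : C(Circle, ℂ)) :
    piStarHom k (powEmb k d) = CStarMatrix.ofMatrix (Matrix.scalar (Fin k) d) := by
  ext i j w
  obtain ⟨z, rfl⟩ := circle_pow_surjective hk w
  have hk' : (k : ℂ) ≠ 0 := by exact_mod_cast hk
  refine mul_left_cancel₀ hk' ((piStarHom_entry hk _ z i j).trans ?_)
  have h1 : ∀ t : ℕ, powEmb k d (circleRoot k ^ t * z) = d (z ^ k) := fun t => by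
    change d ((circleRoot k ^ t * z) ^ k) = _
    rw [mul_pow, circleRoot_pow_pow hk, one_mul]
  simp only [h1, ← Finset.mul_sum]
  have h2 : ∀ t : ℕ, character ((j : ℤ) - i) (circleRoot k ^ t * z)
      = character ((j : ℤ) - i) (circleRoot k ^ t) * character ((j : ℤ) - i) z := fun t => by
    simp [character_apply, mul_zpow]
  simp only [h2, ← Finset.sum_mul, sum_character_circleRoot hk]
  change _ = (k : ℂ) * (Matrix.scalar (Fin k) d i j) (z ^ k)
  rw [Matrix.scalar_apply]
  by_cases hij : i = j
  · subst hij
    simp [character_zero, mul_comm]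
  · rw [Matrix.diagonal_apply_ne _ hij, if_neg]
    · simp
    intro hd
    refine hij (Fin.ext ?_)
    have h3 := Int.eq_zero_of_abs_lt_dvd hd (by rw [abs_lt]; omega)
    omega

/-- The composition of `F_{(1/k) 1}` with the inverse of `q ↦ q(z ^ k)` is the mean over the
`k`-th roots. -/
theorem invFun_powEmb_circleExp (hk : k ≠ 0) (q : C(Circle, ℂ)) (z : Circle) :
    Function.invFun (powEmb k) (circleExp ((k : ℂ)⁻¹ • (1 : Matrix (Fin k) (Fin k) ℂ)) q) (z ^ k)
      = (k : ℂ)⁻¹ * ∑ t ∈ Finset.range k, q (circleRoot k ^ t * z) := by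
  have hk' : (k : ℂ) ≠ 0 := by exact_mod_cast hk
  set d : C(Circle, ℂ) := ∑ i, ∑ j, ((k : ℂ)⁻¹ • (1 : Matrix (Fin k) (Fin k) ℂ)) i j •
    piHom k q j i with hd
  have hpi : piHom k = piStarHom k := funext (piHom_eq k)
  have h1 : circleExp ((k : ℂ)⁻¹ • (1 : Matrix (Fin k) (Fin k) ℂ)) q = powEmb k d := by
    rw [circleExp, traceExp, ← hd, ← piStarHom_powEmb hk, hpi]
    exact Function.leftInverse_invFun (piStarHom_injective hk) _
  rw [h1, Function.leftInverse_invFun (powEmb_injective hk), hd, hpi]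
  have h2 : ∀ i : Fin k, piStarHom k q i i (z ^ k)
      = (k : ℂ)⁻¹ * ∑ t ∈ Finset.range k, q (circleRoot k ^ t * z) := fun i => by
    have := piStarHom_entry hk q z i i
    simp only [sub_self, character_zero, ContinuousMap.one_apply, mul_one] at this
    rw [← this, inv_mul_cancel_left₀ hk']
  simp only [Matrix.smul_apply, Matrix.one_apply, smul_eq_mul, mul_ite, mul_one, mul_zero, ite_smul,
    zero_smul, Finset.sum_ite_eq, Finset.mem_univ, if_true, ContinuousMap.sum_apply,
    ContinuousMap.smul_apply, h2, Finset.sum_const, Finset.card_univ, Fintype.card_fin,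
    nsmul_eq_mul]
  rw [mul_inv_cancel_left₀ hk']

/-- The mean over roots is adjoint to composition with `z ^ k`: substitute `z ↦ z ^ k`, then remove
each root by rotation invariance. -/
theorem integral_invFun_powEmb_circleExp_mul (hk : k ≠ 0) (q r : C(Circle, ℂ)) :
    ∫ z, Function.invFun (powEmb k)
        (circleExp ((k : ℂ)⁻¹ • (1 : Matrix (Fin k) (Fin k) ℂ)) q) z * r z ∂haarCircle
      = ∫ z, q z * powEmb k r z ∂haarCircle := by
  have hk' : (k : ℂ) ≠ 0 := by exact_mod_cast hk
  set d := Function.invFun (powEmb k)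
    (circleExp ((k : ℂ)⁻¹ • (1 : Matrix (Fin k) (Fin k) ℂ)) q) with hd
  have h1 : ∫ z, d z * r z ∂haarCircle = ∫ z : Circle, d (z ^ k) * r (z ^ k) ∂haarCircle := by
    conv_lhs => rw [← (measurePreserving_circle_pow hk).map_eq]
    exact integral_map (measurePreserving_circle_pow hk).measurable.aemeasurable
      (d * r).continuous.aestronglyMeasurable
  have h2 : ∀ z, d (z ^ k) * r (z ^ k) = (k : ℂ)⁻¹ * ∑ t ∈ Finset.range k,
      (q * powEmb k r) (circleRoot k ^ t * z) := fun z => by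
    rw [hd, invFun_powEmb_circleExp hk, mul_assoc, Finset.sum_mul]
    congr 1
    refine Finset.sum_congr rfl fun t _ => ?_
    change _ = q _ * r ((circleRoot k ^ t * z) ^ k)
    rw [mul_pow, circleRoot_pow_pow hk, one_mul]
  rw [h1]
  simp only [h2]
  rw [integral_const_mul, integral_finsetSum _ fun t _ => integrable_haarCircle
    ((q * powEmb k r).comp ⟨fun z => circleRoot k ^ t * z, by fun_prop⟩)]
  rw [Finset.sum_congr rfl fun t _ =>
    integral_haarCircle_mul_left (⇑(q * powEmb k r)) (circleRoot k ^ t)]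
  rw [Finset.sum_const, Finset.card_range, nsmul_eq_mul]
  rw [inv_mul_cancel_left₀ hk']
  rfl

end Shift

theorem character_apply_mul (n : ℤ) (z w : Circle) :
    character n (z * w) = character n z * character n w := by
  simp [character_apply, mul_zpow]

theorem character_neg_mul_self (n : ℤ) (z : Circle) : character (-n) z * character n z = 1 := by
  rw [← ContinuousMap.mul_apply, ← character_add, neg_add_cancel, character_zero]; rfl

/-! ### The fixed-point subalgebra of the skew-product -/

section Fixed

variable {X : Type*} [TopologicalSpace X] [CompactSpace X] [T2Space X]
  [MeasurableSpace X] [BorelSpace X] {θ : X ≃ₜ X} {μ : Measure X} {f : C(X, Circle)}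

theorem skewAut_apply (h : C(X × Circle, ℂ)) (x : X) (z : Circle) :
    skewAut θ f h (x, z) = h (θ x, f x * z) := rfl

theorem mem_fixedSubalgebra_iff {b : C(X × Circle, ℂ)} :
    b ∈ fixedSubalgebra (skewAut θ f) ↔ ∀ x z, b (θ x, f x * z) = b (x, z) := by
  change skewAut θ f b = b ↔ _
  rw [ContinuousMap.ext_iff]
  exact ⟨fun h x z => h (x, z), fun h p => h p.1 p.2⟩

theorem measurePreserving_skewProduct [IsProbabilityMeasure μ] (hθ : MeasurePreserving θ μ μ)
    (f : C(X, Circle)) :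
    MeasurePreserving (skewProduct θ f) (μ.prod haarCircle) (μ.prod haarCircle) :=
  hθ.skew_product (g := fun x z => f x * z)
    ((f.continuous.measurable.comp measurable_fst).mul measurable_snd)
    (ae_of_all _ fun x => map_mul_left_eq_self haarCircle (f x))

/-- The `n`-th Fourier coefficient in the circle variable, as a continuous function. -/
def fourierMap (h : C(X × Circle, ℂ)) (n : ℤ) : C(X, ℂ) where
  toFun x := integralMulCLM haarCircle (character (-n)) (integrable_haarCircle _) (h.curry x)
  continuous_toFun := by fun_prop

theorem fourierMap_apply (h : C(X × Circle, ℂ)) (n : ℤ) (x : X) :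
    fourierMap h n x = ∫ z, h (x, z) * character (-n) z ∂haarCircle := rfl

theorem eq_zero_of_fourierMap {h : C(X × Circle, ℂ)} (hh : ∀ n, fourierMap h n = 0) : h = 0 := by
  ext ⟨x, z⟩
  have : h.curry x = 0 := eq_zero_of_fourier fun n => by
    have := DFunLike.congr_fun (hh (-n)) x
    rw [fourierMap_apply, neg_neg] at this
    exact this
  exact DFunLike.congr_fun this z

theorem isContinuousSolution_fourierMap {b : C(X × Circle, ℂ)}
    (hb : b ∈ fixedSubalgebra (skewAut θ f)) (n : ℤ) :
    IsContinuousSolution θ f n (fourierMap b n) := by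
  intro x
  rw [fourierMap_apply, fourierMap_apply, ← integral_haarCircle_mul_left _ (f x),
    ← integral_mul_const]
  refine integral_congr_ae (Eventually.of_forall fun z => ?_)
  change b (θ x, f x * z) * character (-n) (f x * z) * character n (f x)
    = b (x, z) * character (-n) z
  rw [mem_fixedSubalgebra_iff.1 hb, character_apply_mul]
  linear_combination b (x, z) * character (-n) z * character_neg_mul_self n (f x)

theorem integral_fourierMap_mul [IsProbabilityMeasure μ] (h : C(X × Circle, ℂ)) (w : C(X, ℂ))
    (n : ℤ) : ∫ x, fourierMap h n x * w x ∂μ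
      = ∫ p, h p * (w p.1 * character (-n) p.2) ∂(μ.prod haarCircle) := by
  refine Eq.trans ?_ (integral_prod _
    (integrable_continuousMap (μ.prod haarCircle) (h * tensor w (-n)))).symm
  refine integral_congr_ae (Eventually.of_forall fun x => ?_)
  simp only [fourierMap_apply]
  rw [← integral_mul_const]
  refine integral_congr_ae (Eventually.of_forall fun z => ?_)
  simp only [ContinuousMap.mul_apply, tensor_apply]
  ring

theorem fourierMap_eq_zero_of_not_dvd (hμ : IsUniqueInvariantMeasure θ μ) {b : C(X × Circle, ℂ)}
    (hb : b ∈ fixedSubalgebra (skewAut θ f)) {n : ℤ} (hn : ¬ (mZero θ f : ℤ) ∣ n) :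
    fourierMap b n = 0 := by
  rcases eq_zero_or_continuous_unitary hμ (isContinuousSolution_fourierMap hb n) with
    h | ⟨_, _, w, hw, _⟩
  · exact h
  · exact absurd ((mZero_dvd_iff hμ f n).2 ⟨w, hw⟩) hn

theorem eq_zero_of_nonneg_of_integral_circle {q : C(Circle, ℂ)} (hq : ∀ z, 0 ≤ q z)
    (h : ∫ z, q z ∂haarCircle = 0) : q = 0 := by
  have h1 : ∀ z, q z = (((q z).re : ℝ) : ℂ) := fun z => by
    have := (Complex.nonneg_iff.1 (hq z)).2
    exact Complex.ext (by simp) (by simp [← this])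
  have h2 : ∫ z, (q z).re ∂haarCircle = 0 := by
    have h3 : ∫ z, (((q z).re : ℝ) : ℂ) ∂haarCircle = 0 := by
      rw [← h]; exact integral_congr_ae (Eventually.of_forall fun z => (h1 z).symm)
    rw [integral_complex_ofReal] at h3
    exact_mod_cast h3
  have hc : Continuous fun z => (q z).re := by fun_prop
  ext z
  by_contra hz
  refine (hc.integral_pos_of_hasCompactSupport_nonneg_nonzero (μ := haarCircle) (x := z)
    (HasCompactSupport.of_compactSpace _) (fun z => (Complex.nonneg_iff.1 (hq z)).1) ?_).ne' h2
  intro h0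
  refine hz ?_
  rw [h1, h0]; simp

/-- The product measure is faithful on the fixed-point subalgebra. -/
theorem eq_zero_of_mem_fixed_of_nonneg (hμ : IsUniqueInvariantMeasure θ μ) {b : C(X × Circle, ℂ)}
    (hb : b ∈ fixedSubalgebra (skewAut θ f)) (h0 : ∀ p, 0 ≤ b p)
    (h : ∫ p, b p ∂(μ.prod haarCircle) = 0) : b = 0 := by
  have := hμ.isProbabilityMeasure
  have h1 := isContinuousSolution_fourierMap hb 0
  -- The fibre integral of `b` is continuous and `θ`-invariant, so it vanishes at every `x`; on each
  -- fibre Haar measure is faithful.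
  have h2 := eq_integral_of_invariant hμ (g := fourierMap b 0) fun x => by simpa using h1 x
  have h3 : ∫ x, fourierMap b 0 x ∂μ = 0 := by
    have := integral_fourierMap_mul (μ := μ) b 1 0
    simp only [ContinuousMap.one_apply, mul_one, neg_zero, character_zero] at this
    rw [this, h]
  ext ⟨x, z⟩
  have h4 := h2 x
  rw [h3, fourierMap_apply, neg_zero, character_zero] at h4
  simp only [ContinuousMap.one_apply, mul_one] at h4
  exact DFunLike.congr_fun
    (eq_zero_of_nonneg_of_integral_circle (q := b.curry x) (fun z => h0 (x, z)) h4) z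

/-- `r r⁺ = (r⁺)²` is a nonnegative fixed element, so faithfulness turns an integral inequality into
a pointwise one. -/
theorem nonpos_of_integral_mul_posPart (hμ : IsUniqueInvariantMeasure θ μ) {r : C(X × Circle, ℝ)}
    (hr : ∀ x z, r (θ x, f x * z) = r (x, z))
    (h : ∫ p, r p * max (r p) 0 ∂(μ.prod haarCircle) ≤ 0) (p : X × Circle) : r p ≤ 0 := by
  have h1 : ∀ p, r p * max (r p) 0 = max (r p) 0 ^ 2 := fun p => by
    rcases le_total (r p) 0 with h | h
    · simp [h]
    · rw [max_eq_left h]; ring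
  simp only [h1] at h
  have h2 : ∫ p, max (r p) 0 ^ 2 ∂(μ.prod haarCircle) = 0 :=
    le_antisymm h (integral_nonneg fun p => by positivity)
  have h3 := eq_zero_of_mem_fixed_of_nonneg hμ (f := f)
    (b := ⟨fun p => ((max (r p) 0 ^ 2 : ℝ) : ℂ), by fun_prop⟩)
    (mem_fixedSubalgebra_iff.2 fun x z => by simp only [ContinuousMap.coe_mk, hr])
    (fun p => by
      rw [ContinuousMap.coe_mk, Complex.zero_le_real]; positivity)
    (by simp only [ContinuousMap.coe_mk]; rw [integral_complex_ofReal, h2]; simp)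
  have h4 := DFunLike.congr_fun h3 p
  simp only [ContinuousMap.coe_mk, ContinuousMap.zero_apply, Complex.ofReal_eq_zero] at h4
  exact max_eq_right_iff.1 (pow_eq_zero_iff (two_ne_zero)|>.1 h4)

end Fixed

/-! ### Conditional expectations given by invariant weights -/

namespace UnitarySolutions

variable {X : Type*} [TopologicalSpace X] [CompactSpace X] [T2Space X]
  [MeasurableSpace X] [BorelSpace X] {θ : X ≃ₜ X} {μ : Measure X} {f : C(X, Circle)}

/-- The functional `h ↦ ∫ h p(u(x) z ^ n_o)`. -/
def weight [IsProbabilityMeasure μ] (D : UnitarySolutions θ μ f) (p : C(Circle, ℂ)) :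
    C(X × Circle, ℂ) →L[ℂ] ℂ :=
  integralMulCLM (μ.prod haarCircle) (fun y => p (D.base y))
    (integrable_comp_circle p D.measurable_base)

theorem weight_apply [IsProbabilityMeasure μ] (D : UnitarySolutions θ μ f) (p : C(Circle, ℂ))
    (h : C(X × Circle, ℂ)) :
    D.weight p h = ∫ y, h y * p (D.base y) ∂(μ.prod haarCircle) := rfl

theorem weight_one [IsProbabilityMeasure μ] (D : UnitarySolutions θ μ f) (h : C(X × Circle, ℂ)) :
    D.weight 1 h = ∫ y, h y ∂(μ.prod haarCircle) := by
  simp [weight_apply]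

theorem weight_skewAut [IsProbabilityMeasure μ] (hθ : MeasurePreserving θ μ μ)
    (D : UnitarySolutions θ μ f) (p : C(Circle, ℂ)) (h : C(X × Circle, ℂ)) :
    D.weight p (skewAut θ f h) = D.weight p h := by
  have h1 := (measurePreserving_skewProduct hθ f).integral_comp
    (skewProduct θ f).measurableEmbedding (fun y => h y * p (D.base y))
  rw [weight_apply, weight_apply, ← h1]
  refine integral_congr_ae ?_
  filter_upwards [Measure.quasiMeasurePreserving_fst.ae D.u_eq] with y hy
  have : D.base (skewProduct θ f y) = D.base y := by
    change D.u (θ y.1) * (f y.1 * y.2) ^ nZero θ μ f = D.u y.1 * y.2 ^ nZero θ μ f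
    rw [mul_pow, ← mul_assoc, hy]
  rw [this]
  rfl

theorem weight_nonneg [IsProbabilityMeasure μ] (D : UnitarySolutions θ μ f) {p : C(Circle, ℂ)}
    (hp : ∀ z, 0 ≤ p z) {h : C(X × Circle, ℂ)} (hh : ∀ y, 0 ≤ h y) : 0 ≤ D.weight p h :=
  integral_nonneg fun y => mul_nonneg (hh y) (hp _)

/-- Test `a - b` against its own adjoint and use faithfulness. The algebraic identities for
expectations are checked through this duality. -/
theorem eq_of_weight_one (hμ : IsUniqueInvariantMeasure θ μ) [IsProbabilityMeasure μ]
    (D : UnitarySolutions θ μ f)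
    {a b : C(X × Circle, ℂ)} (ha : a ∈ fixedSubalgebra (skewAut θ f))
    (hb : b ∈ fixedSubalgebra (skewAut θ f))
    (h : ∀ c ∈ fixedSubalgebra (skewAut θ f), D.weight 1 (a * c) = D.weight 1 (b * c)) :
    a = b := by
  have hd : a - b ∈ fixedSubalgebra (skewAut θ f) := sub_mem ha hb
  have h1 : (a - b) * star (a - b) = 0 := by
    refine eq_zero_of_mem_fixed_of_nonneg hμ (mul_mem hd (star_mem hd)) (fun p => ?_) ?_
    · rw [ContinuousMap.mul_apply, ContinuousMap.star_apply]
      exact mul_star_self_nonneg _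
    · rw [← weight_one D, sub_mul, map_sub, h _ (star_mem hd), sub_self]
  exact sub_eq_zero.1 ((CStarRing.mul_star_self_eq_zero_iff _).1 h1)

/-- A map into the fixed-point subalgebra which is dual to the functional of an invariant weight is
an invariant conditional expectation. -/
theorem mem_invariantCondExps_of_weight (hμ : IsUniqueInvariantMeasure θ μ)
    [IsProbabilityMeasure μ] (D : UnitarySolutions θ μ f)
    {p : C(Circle, ℂ)} (hp : ∀ z, 0 ≤ p z)
    (hpB : ∀ b ∈ fixedSubalgebra (skewAut θ f), D.weight p b = D.weight 1 b)
    {E : C(X × Circle, ℂ) → C(X × Circle, ℂ)} (hE : ∀ h, E h ∈ fixedSubalgebra (skewAut θ f))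
    (hw : ∀ h, ∀ b ∈ fixedSubalgebra (skewAut θ f), D.weight 1 (E h * b) = D.weight p (h * b)) :
    E ∈ invariantCondExps (skewAut θ f) := by
  have h_left : ∀ b ∈ fixedSubalgebra (skewAut θ f), ∀ a, E (b * a) = b * E a := fun b hb a => by
    refine eq_of_weight_one hμ D (hE _) (mul_mem hb (hE _)) fun c hc => ?_
    have e1 : b * E a * c = E a * (b * c) := by ring
    have e2 : b * a * c = a * (b * c) := by ring
    rw [hw _ _ hc, e1, hw _ _ (mul_mem hb hc), e2]
  refine ⟨{ linear := ⟨fun a b => ?_, fun c a => ?_⟩, mem := hE, apply_of_mem := fun b hb => ?_,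
            nonneg := fun a ha => ?_, left_mul := h_left, right_mul := fun b hb a => ?_ },
            fun a => ?_⟩
  · refine eq_of_weight_one hμ D (hE _) (add_mem (hE _) (hE _)) fun c hc => ?_
    rw [add_mul, map_add, hw _ _ hc, hw _ _ hc, hw _ _ hc, add_mul, map_add]
  · refine eq_of_weight_one hμ D (hE _) (SMulMemClass.smul_mem _ (hE _)) fun b hb => ?_
    rw [smul_mul_assoc, map_smul, hw _ _ hb, hw _ _ hb, smul_mul_assoc, map_smul]
  · refine eq_of_weight_one hμ D (hE _) hb fun c hc => ?_
    rw [hw _ _ hc, hpB _ (mul_mem hb hc)]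
  · have ha' : ∀ y, 0 ≤ a y := fun y => ha y
    have hfix := mem_fixedSubalgebra_iff.1 (hE a)
    -- Positivity is tested against `r⁺` for invariant real `r`; the choices `-Re (E a)` and `± Im
    -- (E a)` then settle it at every point.
    have key : ∀ r : C(X × Circle, ℝ), (∀ x z, r (θ x, f x * z) = r (x, z)) →
        0 ≤ ∫ y, (E a y) * ((max (r y) 0 : ℝ) : ℂ) ∂(μ.prod haarCircle) := fun r hr => by
      have h1 := hw a ⟨fun y => ((max (r y) 0 : ℝ) : ℂ), by fun_prop⟩
        (mem_fixedSubalgebra_iff.2 fun x z => by simp only [ContinuousMap.coe_mk, hr])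
      have h2 := D.weight_nonneg hp (h := a * ⟨fun y => ((max (r y) 0 : ℝ) : ℂ), by fun_prop⟩)
        fun y => mul_nonneg (ha' y) (Complex.zero_le_real.2 (le_max_right _ _))
      rw [← h1, weight_one] at h2
      exact h2
    have hint : ∀ r : C(X × Circle, ℝ),
        Integrable (fun y => (E a y) * ((max (r y) 0 : ℝ) : ℂ)) (μ.prod haarCircle) := fun r =>
      integrable_continuousMap _ (E a * ⟨fun y => ((max (r y) 0 : ℝ) : ℂ), by fun_prop⟩)
    have hre : ∀ r : C(X × Circle, ℝ), (∀ x z, r (θ x, f x * z) = r (x, z)) →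
        0 ≤ ∫ y, (E a y).re * max (r y) 0 ∂(μ.prod haarCircle) := fun r hr => by
      have h1 := (Complex.nonneg_iff.1 (key r hr)).1
      have h2 := integral_re (hint r)
      simp only [RCLike.re_eq_complex_re, Complex.mul_re, Complex.ofReal_re, Complex.ofReal_im,
        mul_zero, sub_zero] at h2
      rwa [h2]
    have him : ∀ r : C(X × Circle, ℝ), (∀ x z, r (θ x, f x * z) = r (x, z)) →
        ∫ y, (E a y).im * max (r y) 0 ∂(μ.prod haarCircle) = 0 := fun r hr => by
      have h1 := (Complex.nonneg_iff.1 (key r hr)).2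
      have h2 := integral_im (hint r)
      simp only [RCLike.im_eq_complex_im, Complex.mul_im, Complex.ofReal_re, Complex.ofReal_im,
        mul_zero, zero_add] at h2
      rw [h2]; exact h1.symm
    intro y
    change (0 : ℂ) ≤ E a y
    rw [Complex.nonneg_iff]
    refine ⟨?_, le_antisymm ?_ ?_⟩
    · have := nonpos_of_integral_mul_posPart hμ (f := f)
        (r := ⟨fun y => -(E a y).re, by fun_prop⟩) (fun x z => by simp [hfix])
        (by
          have := hre ⟨fun y => -(E a y).re, by fun_prop⟩ (fun x z => by simp [hfix])
          simp only [ContinuousMap.coe_mk, neg_mul, integral_neg] at this ⊢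
          linarith) y
      simpa using this
    · have := nonpos_of_integral_mul_posPart hμ (f := f)
        (r := ⟨fun y => -(E a y).im, by fun_prop⟩) (fun x z => by simp [hfix])
        (by
          have := him ⟨fun y => -(E a y).im, by fun_prop⟩ (fun x z => by simp [hfix])
          simp only [ContinuousMap.coe_mk, neg_mul, integral_neg] at this ⊢
          linarith) y
      simpa using this
    · exact nonpos_of_integral_mul_posPart hμ (f := f)
        (r := ⟨fun y => (E a y).im, by fun_prop⟩) (fun x z => by simp [hfix])
        (him ⟨fun y => (E a y).im, by fun_prop⟩ (fun x z => by simp [hfix])).le y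
  · rw [mul_comm, h_left b hb, mul_comm]
  · refine eq_of_weight_one hμ D (hE _) (hE _) fun c hc => ?_
    have hc' : skewAut θ f c = c := hc
    have e : skewAut θ f (a * c) = skewAut θ f a * c := by rw [map_mul, hc']
    rw [hw _ _ hc, hw _ _ hc, ← D.weight_skewAut hμ.measurePreserving p (a * c), e]

/-! ### The expectations `σ ∘ F ∘ ρ_1 ∘ T` twisted by a weight -/

theorem sigma_mem (D : UnitarySolutions θ μ f) (q : C(Circle, ℂ)) :
    D.sigma q ∈ fixedSubalgebra (skewAut θ f) := by
  refine mem_fixedSubalgebra_iff.2 fun x z => ?_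
  change q (D.v (θ x) * (f x * z) ^ mZero θ f) = q (D.v x * z ^ mZero θ f)
  rw [mul_pow, ← mul_assoc, D.v_eq]

theorem sigma_mul (D : UnitarySolutions θ μ f) (q r : C(Circle, ℂ)) :
    D.sigma q * D.sigma r = D.sigma (q * r) := rfl

/-- The map `h ↦ σ(F(ρ_1(T(h)) p))`, with `F` the mean over the `k_o`-th roots. -/
def weightedExp (D : UnitarySolutions θ μ f) (p : C(Circle, ℂ)) (h : C(X × Circle, ℂ)) :
    C(X × Circle, ℂ) :=
  if mZero θ f = 0 then ContinuousMap.const _ (∫ y, h y * p (D.base y) ∂(μ.prod haarCircle))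
  else D.sigma (Function.invFun (powEmb (kZero θ μ f))
    (circleExp ((kZero θ μ f : ℂ)⁻¹ •
      (1 : Matrix (Fin (kZero θ μ f)) (Fin (kZero θ μ f)) ℂ)) (D.rho (D.T h) * p)))

theorem weightedExp_one (D : UnitarySolutions θ μ f) : D.weightedExp 1 = D.canonicalExp := by
  funext h
  simp only [weightedExp, canonicalExp, condExp, ContinuousMap.one_apply, mul_one]

theorem weightedExp_mem (D : UnitarySolutions θ μ f) (p : C(Circle, ℂ)) (h : C(X × Circle, ℂ)) :
    D.weightedExp p h ∈ fixedSubalgebra (skewAut θ f) := by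
  unfold weightedExp
  split_ifs
  · exact mem_fixedSubalgebra_iff.2 fun _ _ => rfl
  · exact D.sigma_mem _

theorem base_pow_ae_eq (hμ : IsUniqueInvariantMeasure θ μ) [IsProbabilityMeasure μ]
    (D : UnitarySolutions θ μ f) :
    ∀ᵐ y ∂(μ.prod haarCircle), D.base y ^ kZero θ μ f = D.v y.1 * y.2 ^ mZero θ f := by
  filter_upwards [Measure.quasiMeasurePreserving_fst.ae D.v_ae_eq] with y hy
  rw [base, mul_pow, ← pow_mul, mul_comm (nZero θ μ f), kZero_mul_nZero hμ, hy]

theorem nZero_ne_zero (hμ : IsUniqueInvariantMeasure θ μ) (hm : mZero θ f ≠ 0) :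
    nZero θ μ f ≠ 0 := fun h => hm (by rw [← kZero_mul_nZero hμ, h, mul_zero])

theorem kZero_ne_zero (hμ : IsUniqueInvariantMeasure θ μ) (hm : mZero θ f ≠ 0) :
    kZero θ μ f ≠ 0 := fun h => hm (by rw [← kZero_mul_nZero hμ, h, zero_mul])

theorem weight_sigma (hμ : IsUniqueInvariantMeasure θ μ) [IsProbabilityMeasure μ]
    (D : UnitarySolutions θ μ f) (hm : mZero θ f ≠ 0) (p q : C(Circle, ℂ)) :
    D.weight p (D.sigma q) = ∫ z, powEmb (kZero θ μ f) q z * p z ∂haarCircle := by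
  have h1 := D.measurePreserving_base (nZero_ne_zero hμ hm)
  conv_rhs => rw [← h1.map_eq]
  rw [weight_apply]
  refine Eq.trans ?_ (integral_map h1.measurable.aemeasurable
    (powEmb (kZero θ μ f) q * p).continuous.aestronglyMeasurable).symm
  refine integral_congr_ae ?_
  filter_upwards [D.base_pow_ae_eq hμ] with y hy
  change q (D.v y.1 * y.2 ^ mZero θ f) * _ = q (D.base y ^ kZero θ μ f) * _
  rw [hy]

/-- A chain of adjunctions: through `D.base`, `σ` becomes composition with `z ^ k_o`, the mean over
roots is adjoint to that, and `ρ_1 ∘ T` is adjoint to composition with `D.base`. -/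
theorem weight_weightedExp_mul_sigma (hμ : IsUniqueInvariantMeasure θ μ) [IsProbabilityMeasure μ]
    (D : UnitarySolutions θ μ f) (hm : mZero θ f ≠ 0) (p q : C(Circle, ℂ))
    (h : C(X × Circle, ℂ)) :
    D.weight 1 (D.weightedExp p h * D.sigma q) = D.weight p (h * D.sigma q) := by
  have hk := kZero_ne_zero hμ hm
  have hn := nZero_ne_zero hμ hm
  rw [weightedExp, if_neg hm, sigma_mul, weight_sigma hμ D hm]
  set d := Function.invFun (powEmb (kZero θ μ f))
    (circleExp ((kZero θ μ f : ℂ)⁻¹ •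
      (1 : Matrix (Fin (kZero θ μ f)) (Fin (kZero θ μ f)) ℂ)) (D.rho (D.T h) * p)) with hd
  have h1 : ∫ z, powEmb (kZero θ μ f) (d * q) z * (1 : C(Circle, ℂ)) z ∂haarCircle
      = ∫ z, d z * q z ∂haarCircle := by
    simp only [ContinuousMap.one_apply, mul_one]
    conv_rhs => rw [← (measurePreserving_circle_pow hk).map_eq]
    exact (integral_map (measurePreserving_circle_pow hk).measurable.aemeasurable
      (d * q).continuous.aestronglyMeasurable).symm
  rw [h1, hd, integral_invFun_powEmb_circleExp_mul hk]
  have h2 := D.integral_rho_T_mul hn h (p * powEmb (kZero θ μ f) q)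
  simp only [ContinuousMap.mul_apply, ← mul_assoc] at h2 ⊢
  rw [h2, weight_apply]
  refine integral_congr_ae ?_
  filter_upwards [D.base_pow_ae_eq hμ] with y hy
  change _ * q (D.base y ^ kZero θ μ f) = h y * q (D.v y.1 * y.2 ^ mZero θ f) * _
  rw [hy]; ring

/-- When `m_o > 0`, the fixed-point subalgebra is the range of `σ`. -/
theorem exists_sigma_eq (hμ : IsUniqueInvariantMeasure θ μ)
    (D : UnitarySolutions θ μ f) (hm : mZero θ f ≠ 0) {b : C(X × Circle, ℂ)}
    (hb : b ∈ fixedSubalgebra (skewAut θ f)) : ∃ q, b = D.sigma q := by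
  have := hμ.isProbabilityMeasure
  have hd : b - D.weightedExp 1 b ∈ fixedSubalgebra (skewAut θ f) :=
    sub_mem hb (D.weightedExp_mem 1 b)
  -- `weightedExp 1` takes values in the range of `σ`, so it suffices that it fixes `b`.
  suffices h : b - D.weightedExp 1 b = 0 by
    rw [sub_eq_zero, weightedExp, if_neg hm] at h
    exact ⟨_, h⟩
  refine eq_zero_of_fourierMap fun n => ?_
  by_cases hn : (mZero θ f : ℤ) ∣ n
  swap
  · exact fourierMap_eq_zero_of_not_dvd hμ hd hn
  obtain ⟨l, rfl⟩ := hn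
  let w : C(X, Circle) := ⟨fun x => D.v x ^ l, (continuous_zpow l).comp D.v.continuous⟩
  have hw : ∀ x, w (θ x) * f x ^ ((mZero θ f : ℤ) * l) = w x := fun x => by
    change D.v (θ x) ^ l * f x ^ ((mZero θ f : ℤ) * l) = D.v x ^ l
    rw [← D.v_eq x, mul_zpow, zpow_mul, zpow_natCast]
  ext x
  rw [continuous_solution_unique hμ (isContinuousSolution_fourierMap hd _) hw x]
  have h1 := integral_fourierMap_mul (μ := μ) (b - D.weightedExp 1 b)
    ⟨fun x => (((w x)⁻¹ : Circle) : ℂ), by fun_prop⟩ ((mZero θ f : ℤ) * l)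
  -- This pairing is the constant to which `continuous_solution_unique` reduces the Fourier
  -- coefficient at level `m_o l`.
  have h2 : D.weight 1 ((b - D.weightedExp 1 b) * D.sigma (character (-l))) = 0 := by
    rw [sub_mul, map_sub, weight_weightedExp_mul_sigma hμ D hm, sub_self]
  rw [weight_one] at h2
  simp only [ContinuousMap.coe_mk] at h1
  rw [h1]
  have h3 : ∀ p : X × Circle,
      (((w p.1)⁻¹ : Circle) : ℂ) * character (-((mZero θ f : ℤ) * l)) p.2
        = D.sigma (character (-l)) p := fun p => by
    change (((D.v p.1 ^ l)⁻¹ : Circle) : ℂ) * ((p.2 ^ (-((mZero θ f : ℤ) * l)) : Circle) : ℂ)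
      = (((D.v p.1 * p.2 ^ mZero θ f) ^ (-l) : Circle) : ℂ)
    have e : (D.v p.1 ^ l)⁻¹ * p.2 ^ (-((mZero θ f : ℤ) * l))
        = (D.v p.1 * p.2 ^ mZero θ f) ^ (-l) := by
      rw [mul_zpow, ← zpow_natCast p.2, ← zpow_mul, zpow_neg (D.v p.1), mul_neg]
    rw [← e, Circle.coe_mul]
  simp only [h3]
  simp only [ContinuousMap.mul_apply] at h2
  rw [h2]; simp

/-- When `m_o = 0`, the fixed-point subalgebra is trivial. -/
theorem exists_const_eq (hμ : IsUniqueInvariantMeasure θ μ) (hm : mZero θ f = 0)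
    {b : C(X × Circle, ℂ)} (hb : b ∈ fixedSubalgebra (skewAut θ f)) :
    ∃ c, b = ContinuousMap.const _ c := by
  have hc : ∀ c, (ContinuousMap.const _ c : C(X × Circle, ℂ)) ∈ fixedSubalgebra (skewAut θ f) :=
    fun c => mem_fixedSubalgebra_iff.2 fun _ _ => rfl
  refine ⟨∫ x, fourierMap b 0 x ∂μ, sub_eq_zero.1 (eq_zero_of_fourierMap fun n => ?_)⟩
  by_cases hn : n = 0
  · subst hn
    have h1 := isContinuousSolution_fourierMap hb 0
    have h2 := eq_integral_of_invariant hμ (g := fourierMap b 0) fun x => by simpa using h1 x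
    ext x
    have h3 := h2 x
    rw [fourierMap_apply] at h3 ⊢
    simp only [neg_zero, character_zero, ContinuousMap.one_apply, mul_one,
      ContinuousMap.sub_apply, ContinuousMap.const_apply] at h3 ⊢
    refine (integral_sub (integrable_haarCircle (b.curry x)) (integrable_const _)).trans ?_
    rw [show ∫ z, b.curry x z ∂haarCircle = _ from h3]
    simp
  · refine fourierMap_eq_zero_of_not_dvd hμ (sub_mem hb (hc _)) ?_
    rwa [hm, Nat.cast_zero, zero_dvd_iff]

theorem weight_weightedExp_mul (hμ : IsUniqueInvariantMeasure θ μ) [IsProbabilityMeasure μ]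
    (D : UnitarySolutions θ μ f) (p : C(Circle, ℂ))
    (h b : C(X × Circle, ℂ)) (hb : b ∈ fixedSubalgebra (skewAut θ f)) :
    D.weight 1 (D.weightedExp p h * b) = D.weight p (h * b) := by
  by_cases hm : mZero θ f = 0
  · obtain ⟨c, rfl⟩ := exists_const_eq hμ hm hb
    rw [weightedExp, if_pos hm, weight_one, weight_apply]
    simp only [ContinuousMap.mul_apply, ContinuousMap.const_apply, integral_const, probReal_univ,
      one_smul]
    rw [← integral_mul_const]
    exact integral_congr_ae (Eventually.of_forall fun y => by ring)
  · obtain ⟨q, rfl⟩ := D.exists_sigma_eq hμ hm hb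
    exact weight_weightedExp_mul_sigma hμ D hm p q h

theorem canonicalExp_mem (hμ : IsUniqueInvariantMeasure θ μ) (D : UnitarySolutions θ μ f) :
    D.canonicalExp ∈ invariantCondExps (skewAut θ f) := by
  have := hμ.isProbabilityMeasure
  rw [← weightedExp_one]
  exact mem_invariantCondExps_of_weight hμ D (p := 1) (fun _ => zero_le_one) (fun _ _ => rfl)
    (D.weightedExp_mem 1) (fun h b hb => weight_weightedExp_mul hμ D 1 h b hb)

end UnitarySolutions

/-! ### Convergence of averages and uniqueness -/

/-- Positive linear maps between C*-algebras are automatically bounded. -/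
theorem IsCondExp.continuous {A : Type*} [CStarAlgebra A] [PartialOrder A] [StarOrderedRing A]
    {B : StarSubalgebra ℂ A} {E : A → A} (hE : IsCondExp B E) : Continuous E :=
  map_continuous (PositiveLinearMap.mk₀ (hE.linear.mk' E) hE.nonneg)

/-- A `*`-automorphism as a linear map. -/
def autLinear {A : Type*} [CStarAlgebra A] (α : A ≃⋆ₐ[ℂ] A) : A →ₗ[ℂ] A where
  toFun := α
  map_add' := map_add α
  map_smul' := map_smul α

theorem average_autLinear {A : Type*} [CStarAlgebra A] (α : A ≃⋆ₐ[ℂ] A) (N : ℕ) (a : A) :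
    average (autLinear α) N a
      = (N : ℂ)⁻¹ • ∑ k ∈ Finset.range N, (α : A → A)^[k] a := by
  rw [average_apply]
  simp only [Module.End.pow_apply]
  rfl

theorem norm_autLinear_le {A : Type*} [CStarAlgebra A] (α : A ≃⋆ₐ[ℂ] A) (a : A) :
    ‖autLinear α a‖ ≤ ‖a‖ :=
  NonUnitalStarAlgHom.norm_apply_le (α : A →⋆ₐ[ℂ] A) a

/-- Unique ergodicity with respect to the fixed-point subalgebra forces the invariant conditional
expectation to be unique. -/
theorem eq_of_uniquelyErgodicWrtFixed {A : Type*} [CStarAlgebra A] [PartialOrder A]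
    [StarOrderedRing A] {α : A ≃⋆ₐ[ℂ] A} (h : UniquelyErgodicWrtFixed α) {E E' : A → A}
    (hE : E ∈ invariantCondExps α) (hE' : E' ∈ invariantCondExps α) : E = E' := by
  have key : ∀ {E : A → A}, E ∈ invariantCondExps α → ∀ {a b : A},
      Tendsto (fun N => average (autLinear α) N a) atTop (𝓝 b) → E a = b := by
    intro E hE a b hab
    -- The limit is fixed, hence unmoved by `E`, while `E` has the constant value `E a` on the
    -- averages with `N ≠ 0`.
    have hb : b ∈ fixedSubalgebra α := average_fixed_of_tendsto (norm_autLinear_le α) hab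
    rw [← hE.1.apply_of_mem b hb]
    refine tendsto_nhds_unique (tendsto_const_nhds.congr' ?_)
      ((hE.1.continuous.tendsto b).comp hab)
    filter_upwards [eventually_ne_atTop 0] with N hN
    have hinv : ∀ k, E ((α : A → A)^[k] a) = E a := fun k => by
      induction k with
      | zero => rfl
      | succ k ih => rw [Function.iterate_succ_apply', hE.2, ih]
    have hN' : (N : ℂ) ≠ 0 := by exact_mod_cast hN
    let F : A →ₗ[ℂ] A := hE.1.linear.mk' E
    have hF : ∀ a, F a = E a := fun _ => rfl
    rw [Function.comp_apply, ← hF (average _ _ _), average_autLinear, map_smul, map_sum]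
    simp only [hF, hinv, Finset.sum_const, Finset.card_range]
    rw [← Nat.cast_smul_eq_nsmul ℂ, smul_smul, inv_mul_cancel₀ hN', one_smul]
  funext a
  obtain ⟨b, hb⟩ := h a
  have hb' : Tendsto (fun N => average (autLinear α) N a) atTop (𝓝 b) :=
    hb.congr fun N => (average_autLinear α N a).symm
  rw [key hE hb', key hE' hb']

section Convergence

variable {X : Type*} [TopologicalSpace X] [CompactSpace X] [T2Space X]
  [MeasurableSpace X] [BorelSpace X] {θ : X ≃ₜ X} {μ : Measure X} {f : C(X, Circle)}

/-- The map `g ↦ g(x) z ^ n` as a continuous linear map. -/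
def tensorCLM (n : ℤ) : C(X, ℂ) →L[ℂ] C(X × Circle, ℂ) :=
  LinearMap.mkContinuous
    { toFun := fun g => tensor g n
      map_add' := fun g h => by ext; simp [tensor_apply, add_mul]
      map_smul' := fun c g => by ext; simp [tensor_apply, mul_assoc] } 1 (fun g => by
        rw [one_mul, ContinuousMap.norm_le _ (norm_nonneg _)]
        intro p
        change ‖tensor g n p‖ ≤ _
        rw [tensor_apply, norm_mul, norm_character, mul_one]
        exact g.norm_coe_le_norm _)

theorem average_tensor (g : C(X, ℂ)) (n : ℤ) (N : ℕ) :
    average (autLinear (skewAut θ f)) N (tensor g n)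
      = tensorCLM n (average (twist θ f n) N g) := by
  have h1 : ∀ g, skewAut θ f (tensor g n) = tensor (twist θ f n g) n := fun g => by
    ext ⟨x, z⟩
    rw [skewAut_apply, tensor_apply, tensor_apply, twist_apply, character_apply_mul, mul_assoc]
  have h2 : ∀ k, (autLinear (skewAut θ f) ^ k) (tensor g n) = tensorCLM n ((twist θ f n ^ k) g) :=
    fun k => by
      induction k with
      | zero => rfl
      | succ k ih =>
        rw [pow_succ', pow_succ', Module.End.mul_apply, Module.End.mul_apply, ih]
        exact h1 _
  rw [average_apply, average_apply, map_smul, map_sum]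
  simp only [h2]

/-- Multiplication by `w` intertwines the untwisted operator with the twisted one. -/
theorem exists_tendsto_average_twist_of_continuous (hμ : IsUniqueInvariantMeasure θ μ) {n : ℤ}
    {w : C(X, Circle)} (hw : ∀ x, w (θ x) * f x ^ n = w x) (g : C(X, ℂ)) :
    ∃ g', Tendsto (fun N => average (twist θ f n) N g) atTop (𝓝 g') := by
  let W : C(X, ℂ) := ⟨fun x => w x, by fun_prop⟩
  let W' : C(X, ℂ) := ⟨fun x => ((w x)⁻¹ : Circle), by fun_prop⟩
  have hWW : W * (W' * g) = g := by
    ext x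
    change (w x : ℂ) * (((w x)⁻¹ : Circle) * g x) = g x
    rw [Circle.coe_inv, mul_inv_cancel_left₀ (Circle.coe_ne_zero _)]
  have h1 : ∀ g, twist θ f n (W * g) = W * twist θ f 0 g := fun g => by
    ext x
    change (w (θ x) : ℂ) * g (θ x) * ((f x ^ n : Circle) : ℂ)
      = w x * (g (θ x) * character 0 (f x))
    rw [← hw x, character_zero, ContinuousMap.one_apply, Circle.coe_mul]
    ring
  have h2 : ∀ k g, (twist θ f n ^ k) (W * g) = W * (twist θ f 0 ^ k) g := fun k g => by
    induction k with
    | zero => rfl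
    | succ k ih =>
      rw [pow_succ', pow_succ', Module.End.mul_apply, Module.End.mul_apply, ih, h1]
  refine ⟨W * ContinuousMap.const X (∫ y, (W' * g) y ∂μ),
    ((tendsto_average_twist_zero hμ f (W' * g)).const_mul W).congr fun N => ?_⟩
  conv_rhs => rw [← hWW]
  simp only [average_apply, h2, mul_smul_comm, Finset.mul_sum]

theorem uniquelyErgodicWrtFixed_of_continuous_solutions (hμ : IsUniqueInvariantMeasure θ μ)
    (h : ∀ (n : ℤ) (g : Lp ℂ ∞ μ), IsMeasurableSolution θ μ f n g →
      ∃ G : C(X, ℂ), IsContinuousSolution θ f n G ∧ ∀ᵐ x ∂μ, g x = G x) :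
    UniquelyErgodicWrtFixed (skewAut θ f) := by
  have := hμ.isProbabilityMeasure
  have htop := submodule_prod_circle_eq_top
    (convergenceSubmodule (average (autLinear (skewAut θ f))))
    (isClosed_convergenceSubmodule _ (norm_average_le (norm_autLinear_le _))) fun g n => by
      suffices ∃ g', Tendsto (fun N => average (twist θ f n) N g) atTop (𝓝 g') by
        obtain ⟨g', hg'⟩ := this
        exact ⟨tensorCLM n g', (((tensorCLM n).continuous.tendsto g').comp hg').congr fun N =>
          (average_tensor g n N).symm⟩
      by_cases hn : ∃ w, IsUnitarySolution θ μ f n w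
      · obtain ⟨w, hw⟩ := hn
        obtain ⟨g₀, hg₀, hgw, _⟩ := hw.exists_Lp hμ.measurePreserving
        obtain ⟨G, hG, hgG⟩ := h n g₀ hg₀
        rcases eq_zero_or_continuous_unitary hμ hG with rfl | ⟨_, _, w', hw', _⟩
        · obtain ⟨x, h1, h2⟩ := (hgw.and hgG).exists
          rw [h1] at h2
          exact absurd h2 (Circle.coe_ne_zero _)
        · exact exists_tendsto_average_twist_of_continuous hμ hw' g
      · exact ⟨0, tendsto_average_twist_of_no_solution hμ f hn g⟩
  intro a
  have ha : a ∈ convergenceSubmodule (average (autLinear (skewAut θ f))) :=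
    htop ▸ Submodule.mem_top
  obtain ⟨b, hb⟩ := ha
  exact ⟨b, hb.congr fun N => average_autLinear _ N a⟩

/-- Divisibility makes every measurable level a continuous one, and unitary solutions at one level
agree a.e. up to a constant. -/
theorem continuous_solutions_of_dvd (hμ : IsUniqueInvariantMeasure θ μ)
    (hdvd : mZero θ f ∣ nZero θ μ f) (n : ℤ) (g : Lp ℂ ∞ μ) (hg : IsMeasurableSolution θ μ f n g) :
    ∃ G : C(X, ℂ), IsContinuousSolution θ f n G ∧ ∀ᵐ x ∂μ, g x = G x := by
  rcases ae_eq_zero_or_unitary hμ (Lp.aestronglyMeasurable g) hg with h0 | ⟨c, _, w, hw, hgw⟩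
  · exact ⟨0, fun x => by simp, h0⟩
  · have hn : (mZero θ f : ℤ) ∣ n :=
      (Int.natCast_dvd_natCast.2 hdvd).trans ((nZero_dvd_iff hμ f n).2 ⟨w, hw⟩)
    obtain ⟨w', hw'⟩ := (mZero_dvd_iff hμ f n).1 hn
    obtain ⟨c', hc'⟩ := hw.ae_eq_const_mul hμ (isUnitarySolution_of_continuous hw')
    refine ⟨⟨fun x => c * (c' * w' x : Circle), by fun_prop⟩, fun x => ?_, ?_⟩
    · simp only [ContinuousMap.coe_mk]
      rw [← hw' x, mul_assoc, ← Circle.coe_mul, mul_assoc]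
    · filter_upwards [hgw, hc'] with x h1 h2
      rw [h1, h2]; rfl

end Convergence

/-! ### Perturbations of the canonical expectation -/

/-- The nonnegative function `1 + s Re z`, for `s = ± 1`. -/
def perturbation (s : ℤˣ) : C(Circle, ℂ) :=
  1 + (((s : ℤ) : ℂ) / 2) • (character 1 + character (-1))

theorem perturbation_nonneg (s : ℤˣ) (z : Circle) : 0 ≤ perturbation s z := by
  have h1 : perturbation s z = ((1 + (s : ℤ) * (z : ℂ).re : ℝ) : ℂ) := by
    have h2 : (z : ℂ) + ((z⁻¹ : Circle) : ℂ) = ((2 * (z : ℂ).re : ℝ) : ℂ) := by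
      rw [Circle.coe_inv_eq_conj, Complex.add_conj]
    simp only [perturbation, ContinuousMap.add_apply, ContinuousMap.smul_apply,
      ContinuousMap.one_apply, character_apply, zpow_one, zpow_neg, smul_eq_mul]
    rw [h2]
    push_cast
    ring
  rw [h1, Complex.zero_le_real]
  have h3 := abs_le.1 ((Complex.abs_re_le_norm (z : ℂ)).trans (Circle.norm_coe z).le)
  rcases Int.units_eq_one_or s with rfl | rfl
  · simp; linarith
  · simp; linarith

namespace UnitarySolutions

variable {X : Type*} [TopologicalSpace X] [CompactSpace X] [T2Space X]
  [MeasurableSpace X] [BorelSpace X] {θ : X ≃ₜ X} {μ : Measure X} {f : C(X, Circle)}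

theorem weight_perturbation [IsProbabilityMeasure μ] (D : UnitarySolutions θ μ f) (s : ℤˣ)
    (h : C(X × Circle, ℂ)) :
    D.weight (perturbation s) h = D.weight 1 h
      + ((s : ℤ) : ℂ) / 2 * (D.weight (character 1) h + D.weight (character (-1)) h) := by
  have key : ∀ p, D.weight p h
      = integralCompCLM (μ.prod haarCircle) D.measurable_base
          (integrable_continuousMap (μ.prod haarCircle) h) p := fun p => by
    rw [weight_apply, integralCompCLM_apply]
    simp only [mul_comm]
  simp only [key, perturbation, map_add, map_smul, smul_eq_mul]

/-- If `m_o = 0`, fixed elements are constants and `χ_{±1}` has mean zero. If `m_o > 0`, then `k_o >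
1`, and rotation by a primitive `k_o`-th root fixes functions of `z ^ k_o` but multiplies `χ_{±1}`
by a factor other than `1`. -/
theorem weight_character_eq_zero (hμ : IsUniqueInvariantMeasure θ μ) [IsProbabilityMeasure μ]
    (D : UnitarySolutions θ μ f) (hn : nZero θ μ f ≠ 0) (hdvd : ¬ mZero θ f ∣ nZero θ μ f)
    {e : ℤ} (he : IsUnit e) {b : C(X × Circle, ℂ)} (hb : b ∈ fixedSubalgebra (skewAut θ f)) :
    D.weight (character e) b = 0 := by
  by_cases hm : mZero θ f = 0
  · obtain ⟨c, rfl⟩ := exists_const_eq hμ hm hb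
    rw [weight_apply]
    simp only [ContinuousMap.const_apply]
    rw [integral_const_mul]
    have h1 := D.measurePreserving_base hn
    have h2 : ∫ y, character e (D.base y) ∂(μ.prod haarCircle) = ∫ z, character e z ∂haarCircle := by
      conv_rhs => rw [← h1.map_eq]
      exact (integral_map h1.measurable.aemeasurable
        (character e).continuous.aestronglyMeasurable).symm
    rw [h2, integral_character, if_neg he.ne_zero, mul_zero]
  · obtain ⟨q, rfl⟩ := D.exists_sigma_eq hμ hm hb
    have hk := kZero_ne_zero hμ hm
    have hk1 : ¬ (kZero θ μ f : ℤ) ∣ e := fun hd => by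
      have h1 : (kZero θ μ f : ℤ) ∣ 1 := hd.trans he.dvd
      have h2 : kZero θ μ f = 1 := by exact_mod_cast Int.eq_one_of_dvd_one (by positivity) h1
      refine hdvd ?_
      rw [← kZero_mul_nZero hμ, h2, one_mul]
    rw [weight_sigma hμ D hm, ← integral_haarCircle_mul_left _ (circleRoot (kZero θ μ f))]
    have h1 : ∀ z, powEmb (kZero θ μ f) q (circleRoot (kZero θ μ f) * z)
          * character e (circleRoot (kZero θ μ f) * z)
        = character e (circleRoot (kZero θ μ f)) * (powEmb (kZero θ μ f) q z * character e z) := by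
      intro z
      change q ((circleRoot (kZero θ μ f) * z) ^ kZero θ μ f) * _
        = _ * (q (z ^ kZero θ μ f) * _)
      have h2 := circleRoot_pow_pow hk 1
      rw [pow_one] at h2
      rw [mul_pow, h2, one_mul, character_apply_mul]
      ring
    have h3 := integral_haarCircle_mul_left
      (fun z => powEmb (kZero θ μ f) q z * character e z) (circleRoot (kZero θ μ f))
    simp only [h1] at h3 ⊢
    rw [integral_const_mul] at h3 ⊢
    have h4 : character e (circleRoot (kZero θ μ f)) - 1 ≠ 0 := by
      rw [sub_ne_zero, character_apply, Ne, Circle.coe_eq_one, circleRoot_zpow_eq_one_iff hk]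
      exact hk1
    rw [h3]
    refine (mul_eq_zero.1 ?_).resolve_left h4
    rw [sub_mul, h3, one_mul, sub_self]

theorem weightedExp_perturbation_mem (hμ : IsUniqueInvariantMeasure θ μ)
    (D : UnitarySolutions θ μ f) (hn : nZero θ μ f ≠ 0) (hdvd : ¬ mZero θ f ∣ nZero θ μ f)
    (s : ℤˣ) : D.weightedExp (perturbation s) ∈ invariantCondExps (skewAut θ f) := by
  have := hμ.isProbabilityMeasure
  refine mem_invariantCondExps_of_weight hμ D (perturbation_nonneg s) (fun b hb => ?_)
    (D.weightedExp_mem _) (fun h b hb => weight_weightedExp_mul hμ D _ h b hb)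
  rw [weight_perturbation, D.weight_character_eq_zero hμ hn hdvd isUnit_one hb,
    D.weight_character_eq_zero hμ hn hdvd isUnit_one.neg hb]
  simp

theorem canonicalExp_eq_midpoint (hμ : IsUniqueInvariantMeasure θ μ)
    (D : UnitarySolutions θ μ f) :
    D.canonicalExp = (1 / 2 : ℝ) • D.weightedExp (perturbation 1)
      + (1 / 2 : ℝ) • D.weightedExp (perturbation (-1)) := by
  have := hμ.isProbabilityMeasure
  funext h
  rw [← weightedExp_one]
  have e : ∀ a : C(X × Circle, ℂ), (1 / 2 : ℝ) • a = (1 / 2 : ℂ) • a := fun a => by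
    ext; simp
  simp only [Pi.add_apply, Pi.smul_apply, e]
  refine eq_of_weight_one hμ D (D.weightedExp_mem _ _)
    (add_mem (SMulMemClass.smul_mem _ (D.weightedExp_mem _ _))
      (SMulMemClass.smul_mem _ (D.weightedExp_mem _ _))) fun c hc => ?_
  rw [add_mul, smul_mul_assoc, smul_mul_assoc, map_add, map_smul, map_smul,
    weight_weightedExp_mul hμ D _ h c hc, weight_weightedExp_mul hμ D _ h c hc,
    weight_weightedExp_mul hμ D _ h c hc, weight_perturbation, weight_perturbation]
  simp only [smul_eq_mul, Units.val_one, Units.val_neg, Int.cast_one, Int.cast_neg]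
  ring

/-- Equality would give `∫ h (a_1 + a_{-1}) = 0` for all `h`. On `h = g z ^ (-n_o)` only `a_1`
contributes, so `∫ g u = 0` for all continuous `g`, impossible as `|u| = 1`. -/
theorem weightedExp_perturbation_ne (hμ : IsUniqueInvariantMeasure θ μ)
    (D : UnitarySolutions θ μ f) (hn : nZero θ μ f ≠ 0) :
    D.weightedExp (perturbation 1) ≠ D.canonicalExp := by
  have := hμ.isProbabilityMeasure
  have := hμ.regular
  intro heq
  rw [← weightedExp_one] at heq
  have h1 : ∀ h, D.weight (character 1) h + D.weight (character (-1)) h = 0 := fun h => by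
    have h2 := weight_weightedExp_mul hμ D (perturbation 1) h 1 (one_mem _)
    rw [heq, weight_weightedExp_mul hμ D 1 h 1 (one_mem _), weight_perturbation, mul_one] at h2
    simpa using h2
  have h2 : ∀ g : C(X, ℂ), ∫ x, g x * (D.u x : ℂ) ∂μ = 0 := fun g => by
    have h3 := h1 (tensor g (-(nZero θ μ f : ℤ)))
    rw [weight_apply, weight_apply] at h3
    have h4 := integral_tensor_mul (μ := μ) D.u (nZero θ μ f) g (-(nZero θ μ f : ℤ)) 1
    have h5 := integral_tensor_mul (μ := μ) D.u (nZero θ μ f) g (-(nZero θ μ f : ℤ)) (-1)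
    rw [if_pos (by ring)] at h4
    -- The exponent is `-2 n_o`, nonzero because `n_o ≠ 0`.
    rw [if_neg (by omega)] at h5
    unfold base at h3
    rw [h4, h5, add_zero] at h3
    simpa [character_apply] using h3
  have hm : MemLp (fun x => (D.u x : ℂ)) 2 μ :=
    (memLp_comp μ ⟨((↑) : Circle → ℂ), continuous_subtype_val⟩ D.measurable_u).mono_exponent le_top
  obtain ⟨x, hx⟩ := (ae_eq_zero_of_integral_continuous hm h2).exists
  exact Circle.coe_ne_zero _ hx

theorem dvd_of_canonicalExp_mem_extremePoints (hμ : IsUniqueInvariantMeasure θ μ)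
    (D : UnitarySolutions θ μ f)
    (h : D.canonicalExp ∈ Set.extremePoints ℝ (invariantCondExps (skewAut θ f))) :
    mZero θ f ∣ nZero θ μ f := by
  by_contra hdvd
  have hn : nZero θ μ f ≠ 0 := fun h0 => hdvd (h0 ▸ dvd_zero _)
  refine D.weightedExp_perturbation_ne hμ hn
    (h.2 (D.weightedExp_perturbation_mem hμ hn hdvd 1) (D.weightedExp_perturbation_mem hμ hn hdvd (-1))
      ⟨1 / 2, 1 / 2, by norm_num, by norm_num, by norm_num, ?_⟩)
  exact (D.canonicalExp_eq_midpoint hμ).symm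

end UnitarySolutions

end Anzai

end

/-! ### The equivalence of the four conditions -/

theorem mainTheorem2 {X : Type*} [TopologicalSpace X] [CompactSpace X] [T2Space X]
    [MeasurableSpace X] [BorelSpace X] (θ : X ≃ₜ X) (μ : MeasureTheory.Measure X)
    (hμ : Anzai.IsUniqueInvariantMeasure θ μ) (f : C(X, Circle)) :
    Nonempty (Anzai.UnitarySolutions θ μ f) ∧
    ∀ D : Anzai.UnitarySolutions θ μ f,
      D.canonicalExp ∈ Anzai.invariantCondExps (Anzai.skewAut θ f) ∧
      List.TFAE
        [ -- (i) unique ergodicity with respect to the fixed-point subalgebra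
          Anzai.UniquelyErgodicWrtFixed (Anzai.skewAut θ f),
          -- (ii) there is only one invariant conditional expectation
          ∃! E, E ∈ Anzai.invariantCondExps (Anzai.skewAut θ f),
          -- (iii) all measurable solutions of the cohomological equations are continuous
          ∀ (n : ℤ) (g : MeasureTheory.Lp ℂ ⊤ μ), Anzai.IsMeasurableSolution θ μ f n g →
            ∃ G : C(X, ℂ), Anzai.IsContinuousSolution θ f n G ∧ ∀ᵐ x ∂μ, g x = G x,
          -- (iv) the canonical expectation is extreme
          D.canonicalExp ∈
            Set.extremePoints ℝ (Anzai.invariantCondExps (Anzai.skewAut θ f)) ] := by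
  refine ⟨Anzai.nonempty_unitarySolutions hμ f, fun D => ⟨D.canonicalExp_mem hμ, ?_⟩⟩
  tfae_have 1 → 2 := fun h => ⟨D.canonicalExp, D.canonicalExp_mem hμ, fun E hE =>
    Anzai.eq_of_uniquelyErgodicWrtFixed h hE (D.canonicalExp_mem hμ)⟩
  tfae_have 2 → 4 := fun h =>
    ⟨D.canonicalExp_mem hμ, fun E hE _ _ _ => h.unique hE (D.canonicalExp_mem hμ)⟩
  tfae_have 4 → 3 := fun h => Anzai.continuous_solutions_of_dvd hμ
    (D.dvd_of_canonicalExp_mem_extremePoints hμ h)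
  tfae_have 3 → 1 := Anzai.uniquelyErgodicWrtFixed_of_continuous_solutions hμ
  tfae_finish
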